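/- Let $d\ge 2$ and $k\ge 2$ be integers. An $\mathbf{o}$-symmetric convex body $\mathbf{K}_{\mathbf{o}}\subset\mathbb{R}^d$ is a compact convex set with nonempty interior that is symmetric about the origin; let $\mathcal{K}_{\mathbf{o}}^d$ be the family of all of them, let $\|x\|_{\mathbf{K}_{\mathbf{o}}}=\min\{\lambda\ge 0 : x\in\lambda\mathbf{K}_{\mathbf{o}}\}$, and let $\mathbb{M}^d_{\mathbf{K}_{\mathbf{o}}}$ be $\mathbb{R}^d$ with this norm. A point configuration of $n\ge1$ points is a labelled family $X=(x_1,\dots,x_n)$ of not necessarily distinct points of $\mathbb{R}^d$. $X$ is *$k$-diametral in $\mathbb{M}^d_{\mathbf{K}_{\mathbf{o}}}$* if its diameter $\max_{i<j}\|x_i-x_j\|_{\mathbf{K}_{\mathbf{o}}}$ is positive (so $n\ge 2$) and, for all indices $n_1<\dots<n_k$, some two of the points $x_{n_1},\dots,x_{n_k}$ with different indices are at distance equal to the diameter. $X$ is *$k$-antipodal in $\mathbb{R}^d$* if, for all indices $n_1<\dots<n_k$, some two of the points $x_{n_1},\dots,x_{n_k}$ with different indices lie on distinct parallel supporting hyperplanes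 of $\mathrm{conv}(X)$, one on each. Let $f_k(\mathbb{M}^d_{\mathbf{K}_{\mathbf{o}}})$ and $F_k(d)$ be the largest $n$ for which there is a $k$-diametral configuration of $n$ points in $\mathbb{M}^d_{\mathbf{K}_{\mathbf{o}}}$, respectively a $k$-antipodal configuration of $n$ points in $\mathbb{R}^d$. An affine $d$-cube is the image of $[0,1]^d$ under an invertible affine map onto $\mathbb{R}^d$. Then the following hold. 1. Let $X$ be a point configuration of $n\ge1$ points in $\mathbb{R}^d$, and suppose that $n\ge k$ or that the points of $X$ do not all coincide. Then $X$ is $k$-antipodal in $\mathbb{R}^d$ if and only if there is $\mathbf{K}_{\mathbf{o}}\in\mathcal{K}_{\mathbf{o}}^d$ such that $X$ is $k$-diametral in $\mathbb{M}^d_{\mathbf{K}_{\mathbf{o}}}$. 2. The maxima defining $F_k(d)$ and $f_k(\mathbb{M}^d_{\mathbf{K}_{\mathbf{o}}})$, for every $\mathbf{K}_{\mathbf{o}}\in\mathcal{K}_{\mathbf{o}}^d$, exist, and $$F_k(d)=\max_{\mathbf{K}_{\mathbf{o}}\in\mathcal{K}_{\mathbf{o}}^d} f_k(\mathbb{M}^d_{\mathbf{K}_{\mathbf{o}}})=(k-1)2^d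 .$$ 3. For $\mathbf{K}_{\mathbf{o}}\in\mathcal{K}_{\mathbf{o}}^d$, one has $f_k(\mathbb{M}^d_{\mathbf{K}_{\mathbf{o}}})=(k-1)2^d$ if and only if $\mathbf{K}_{\mathbf{o}}$ is an affine $d$-cube. In that case, a configuration $X$ of $(k-1)2^d$ points is $k$-diametral in $\mathbb{M}^d_{\mathbf{K}_{\mathbf{o}}}$ if and only if $X$ consists of the vertices of an affine $d$-cube $y+r\mathbf{K}_{\mathbf{o}}$ ($y\in\mathbb{R}^d$, $r>0$) homothetic to $\mathbf{K}_{\mathbf{o}}$, each vertex occurring with multiplicity exactly $k-1$. -/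

import Mathlib

open scoped Pointwise

namespace KDiametral

/-- The family of `o`-symmetric convex bodies of `ℝ^d`: compact convex sets with nonempty interior
that are symmetric about the origin. Only the linear structure and the topology of `ℝ^d` are
used. -/
def symmConvexBodies (d : ℕ) : Set (Set (EuclideanSpace ℝ (Fin d))) :=
  {K | Convex ℝ K ∧ IsCompact K ∧ (interior K).Nonempty ∧ ∀ x ∈ K, -x ∈ K}

/-- The norm generated by `K`, as Mathlib's Minkowski functional. See `isLeast_bodyNorm`: on a
symmetric convex body it is `min {r ≥ 0 | x ∈ r • K}`. -/
noncomputable def bodyNorm {d : ℕ} (K : Set (EuclideanSpace ℝ (Fin d)))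
    (x : EuclideanSpace ℝ (Fin d)) : ℝ :=
  gauge K x

theorem isLeast_bodyNorm {d : ℕ} {K : Set (EuclideanSpace ℝ (Fin d))}
    (hK : K ∈ symmConvexBodies d) (x : EuclideanSpace ℝ (Fin d)) :
    IsLeast {r : ℝ | 0 ≤ r ∧ x ∈ r • K} (bodyNorm K x) := by
  obtain ⟨hc, hcomp, ⟨p, hp⟩, hs⟩ := hK
  have hsymm : -K = K := by
    ext y
    refine ⟨fun hy => ?_, fun hy => ?_⟩
    · simpa using hs _ hy
    · exact hs _ hy
  have hp' : -p ∈ interior K := by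
    have h := (Homeomorph.neg (EuclideanSpace ℝ (Fin d))).image_interior K
    have h' : -p ∈ (Homeomorph.neg (EuclideanSpace ℝ (Fin d))) '' interior K := ⟨p, hp, rfl⟩
    rw [h] at h'
    simpa [hsymm] using h'
  have h0 : (0 : EuclideanSpace ℝ (Fin d)) ∈ interior K := by
    have h := hc.interior hp hp' (a := 1 / 2) (b := 1 / 2) (by norm_num) (by norm_num)
      (by norm_num)
    simpa using h
  have hn : K ∈ nhds (0 : EuclideanSpace ℝ (Fin d)) := mem_interior_iff_mem_nhds.1 h0
  have habs : Absorbent ℝ K := absorbent_nhds_zero hn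
  have hb : Bornology.IsVonNBounded ℝ K := hcomp.isVonNBounded ℝ
  have hle : ∀ y, gauge K y ≤ 1 → y ∈ K := fun y hy =>
    hcomp.isClosed.closure_subset ((gauge_le_one_iff_mem_closure hc hn).1 hy)
  refine ⟨⟨gauge_nonneg _, ?_⟩, ?_⟩
  · rcases eq_or_ne x 0 with rfl | hx
    · simp only [bodyNorm, gauge_zero]
      exact ⟨0, interior_subset h0, by simp⟩
    · have hpos : 0 < gauge K x := (gauge_pos habs hb).2 hx
      refine ⟨(gauge K x)⁻¹ • x, hle _ ?_, ?_⟩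
      · rw [gauge_smul_of_nonneg (inv_nonneg.2 hpos.le), smul_eq_mul, inv_mul_cancel₀ hpos.ne']
      · simp [bodyNorm, smul_smul, mul_inv_cancel₀ hpos.ne']
  · rintro r ⟨hr, hxr⟩
    exact gauge_le_of_mem hr hxr

/-- The diameter `max {‖x i - x j‖ | i < j}` of a point configuration. A configuration of at most
one point gets the value `0`. -/
noncomputable def configDiam {d n : ℕ} (K : Set (EuclideanSpace ℝ (Fin d)))
    (x : Fin n → EuclideanSpace ℝ (Fin d)) : ℝ :=
  sSup {r : ℝ | ∃ i j : Fin n, i < j ∧ r = bodyNorm K (x i - x j)}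

/-- `x` is a `k`-diametral point configuration of `n` points in the Minkowski space of `K`: it has
positive diameter and among any `k` of its (labelled) points there are two at distance equal to
the diameter. -/
def IsKDiametral {d n : ℕ} (K : Set (EuclideanSpace ℝ (Fin d))) (k : ℕ)
    (x : Fin n → EuclideanSpace ℝ (Fin d)) : Prop :=
  0 < configDiam K x ∧
    ∀ s : Finset (Fin n), s.card = k →
      ∃ i ∈ s, ∃ j ∈ s, i < j ∧ bodyNorm K (x i - x j) = configDiam K x

/-- The affine subspace `H` is a supporting hyperplane of `C`: it is a hyperplane that meets `C`,
and `C` lies in one of the closed half-spaces bounded by `H`. -/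
def IsSupportingHyperplane {d : ℕ} (H : AffineSubspace ℝ (EuclideanSpace ℝ (Fin d)))
    (C : Set (EuclideanSpace ℝ (Fin d))) : Prop :=
  ∃ (f : EuclideanSpace ℝ (Fin d) →ₗ[ℝ] ℝ) (c : ℝ),
    f ≠ 0 ∧ (H : Set (EuclideanSpace ℝ (Fin d))) = {y | f y = c} ∧
      (∃ y ∈ C, y ∈ H) ∧ ∀ y ∈ C, f y ≤ c

/-- `a` and `b` lie on distinct parallel supporting hyperplanes of `C`. -/
def AreAntipodal {d : ℕ} (C : Set (EuclideanSpace ℝ (Fin d)))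
    (a b : EuclideanSpace ℝ (Fin d)) : Prop :=
  ∃ H₁ H₂ : AffineSubspace ℝ (EuclideanSpace ℝ (Fin d)),
    IsSupportingHyperplane H₁ C ∧ IsSupportingHyperplane H₂ C ∧
      H₁ ≠ H₂ ∧ H₁.Parallel H₂ ∧ a ∈ H₁ ∧ b ∈ H₂

/-- `x` is a `k`-antipodal point configuration: among any `k` of its (labelled) points there are
two that are antipodal with respect to the convex hull of the configuration. -/
def IsKAntipodal {d n : ℕ} (k : ℕ) (x : Fin n → EuclideanSpace ℝ (Fin d)) : Prop :=
  ∀ s : Finset (Fin n), s.card = k →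
    ∃ i ∈ s, ∃ j ∈ s, i < j ∧ AreAntipodal (convexHull ℝ (Set.range x)) (x i) (x j)

/-- The numbers of points of the `k`-diametral point configurations in the space of `K`. -/
def diametralSizes {d : ℕ} (K : Set (EuclideanSpace ℝ (Fin d))) (k : ℕ) : Set ℕ :=
  {n | 1 ≤ n ∧ ∃ x : Fin n → EuclideanSpace ℝ (Fin d), IsKDiametral K k x}

/-- The `k`-diametral number `f_k` of the Minkowski space of `K`. -/
noncomputable def diametralNumber {d : ℕ} (K : Set (EuclideanSpace ℝ (Fin d))) (k : ℕ) : ℕ :=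
  sSup (diametralSizes K k)

/-- The numbers of points of the `k`-antipodal point configurations in `ℝ^d`. -/
def antipodalSizes (d k : ℕ) : Set ℕ :=
  {n | 1 ≤ n ∧ ∃ x : Fin n → EuclideanSpace ℝ (Fin d), IsKAntipodal k x}

/-- The `k`-antipodal number `F_k(d)`. -/
noncomputable def antipodalNumber (d k : ℕ) : ℕ :=
  sSup (antipodalSizes d k)

/-- An affine `d`-cube: the image of `[0,1]^d` under an invertible affine map. -/
def IsAffineCube {d : ℕ} (C : Set (EuclideanSpace ℝ (Fin d))) : Prop :=
  ∃ φ : (Fin d → ℝ) ≃ᵃ[ℝ] EuclideanSpace ℝ (Fin d), C = φ '' Set.Icc 0 1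

/-- `C` is a (positive) homothetic copy of `K`. -/
def IsHomothetic {d : ℕ} (C K : Set (EuclideanSpace ℝ (Fin d))) : Prop :=
  ∃ (y : EuclideanSpace ℝ (Fin d)) (r : ℝ), 0 < r ∧ C = y +ᵥ r • K

/-- `x` is the vertex set of `C` with each vertex having multiplicity `m`. -/
def IsVertexConfig {d n : ℕ} (C : Set (EuclideanSpace ℝ (Fin d))) (m : ℕ)
    (x : Fin n → EuclideanSpace ℝ (Fin d)) : Prop :=
  (∀ i, x i ∈ Set.extremePoints ℝ C) ∧
    ∀ v ∈ Set.extremePoints ℝ C, {i | x i = v}.ncard = m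

end KDiametral

/-! Let `P` be the convex hull of `X`, and shrink `P` by the factor 1/2 towards each `x i`. These
half-size copies lie in `P`, and no point is interior to `k` of them: among any `k` centres two are
antipodal, and the hyperplane midway between their supporting hyperplanes separates the interiors of
the two copies. Comparing volumes gives `n / 2 ^ d ≤ k - 1` (`card_mul_measure_interior_add_le`). A
configuration that does not span is treated in its own span, where the bound is stronger.

In the equality case the points covered at least `k - 1` times are dense in `P`
(`exists_le_card_filter_interior`). Close to an extreme point only copies centred at it are
available, so it has multiplicity `k - 1`; then it is antipodal to every point of `X` different from
it, which forces all points of `X` to be extreme. Hence `X` consists of `2 ^ d` pairwise antipodal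
vertices, forming a set `V`, and after doubling, the closed tiles `P + v` with `v ∈ V` cover `2 P`.

That `P` is a parallelotope is seen by following a generic line of direction `u` whose part in `2 P`
is longer than every chord of `P`. It passes from one tile `P + v` to another tile `P + w`, and a
functional for which `v` and `w` are antipodal has a facet on each side, both transversal to `u`
(`exists_facet_pair`). The covering property passes to faces, so by volume each facet contains at
least `2 ^ (d - 1)` points of `V` (`two_pow_finrank_le_of_facet`). The two facets exhaust `V`, so
the functional takes two values on `V` and is nonzero at `u`. Since `u` is arbitrary, such
functionals span the dual, and `d` of them serve as cube coordinates
(`exists_affineEquiv_eq_image`).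

On the side of norms, a supporting functional of the difference of a diametral pair shows that the
pair is antipodal; conversely, slabs cut out by normalised antipodal functionals bound a suitable
unit ball (`IsKAntipodal.exists_isKDiametral`). In an extremal `k`-diametral configuration all
distances of distinct vertices are equal, and this determines `K` up to homothety
(`eq_vadd_smul_of_forall_bodyNorm_eq`). -/

namespace KDiametral

open MeasureTheory Module Set

/-! ### Antipodal pairs and half-size copies of a convex set. -/

section Antipodal
variable {E : Type*} [NormedAddCommGroup E] [NormedSpace ℝ E]

/-- A linear functional attains its maximum over `P` at `a` and its minimum at `b`, and these
two values differ. -/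
def IsAntipodalPair (P : Set E) (a b : E) : Prop :=
  ∃ f : E →ₗ[ℝ] ℝ, f b < f a ∧ ∀ p ∈ P, f b ≤ f p ∧ f p ≤ f a

theorem IsAntipodalPair.symm {P : Set E} {a b : E} (h : IsAntipodalPair P a b) :
    IsAntipodalPair P b a := by
  obtain ⟨f, hf, h⟩ := h
  exact ⟨-f, by simpa using hf, fun p hp => by simpa using (h p hp).symm⟩

theorem IsAntipodalPair.ne {P : Set E} {a b : E} (h : IsAntipodalPair P a b) : a ≠ b := by
  rintro rfl
  obtain ⟨f, hf, -⟩ := h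
  exact hf.false

theorem lt_of_mem_interior_of_forall_le {P : Set E} {f : E →ₗ[ℝ] ℝ} {m : ℝ} (hf : f ≠ 0)
    (h : ∀ p ∈ P, m ≤ f p) {z : E} (hz : z ∈ interior P) : m < f z := by
  obtain ⟨u, hu⟩ : ∃ u, f u ≠ 0 := by
    by_contra! hc
    exact hf (LinearMap.ext hc)
  have hc : Continuous fun t : ℝ => z - t • (f u) • u := by fun_prop
  have hev : ∀ᶠ t in nhds (0 : ℝ), z - t • (f u) • u ∈ interior P :=
    hc.continuousAt.eventually_mem (isOpen_interior.mem_nhds (by simpa using hz))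
  obtain ⟨t, ht, ht0⟩ := ((hev.filter_mono nhdsWithin_le_nhds).and
    (self_mem_nhdsWithin (s := Ioi (0 : ℝ)))).exists
  have h1 := h _ (interior_subset ht)
  simp only [map_sub, map_smul, smul_eq_mul] at h1
  have h2 : 0 < t * (f u * f u) := mul_pos ht0 (mul_self_pos.2 hu)
  linarith

/-- `p` is the midpoint of `x` and `2p - x`. This keeps the half-size copies inside `P`, so that
their total volume can be bounded. -/
theorem subset_interior_setOf_two_smul_sub_mem {P : Set E} (hP : Convex ℝ P) {x : E} (hx : x ∈ P) :
    {p : E | (2 : ℝ) • p - x ∈ interior P} ⊆ interior P := by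
  apply interior_maximal
  · intro p hp
    have h := hP hx (interior_subset hp) (a := 1 / 2) (b := 1 / 2) (by norm_num) (by norm_num)
      (by norm_num)
    convert h using 1
    module
  · exact isOpen_interior.preimage (by fun_prop)

end Antipodal

/-! ### The volume inequality and its equality case. -/

section Counting
variable {E : Type*} [NormedAddCommGroup E] [NormedSpace ℝ E] {ι : Type*} [Fintype ι]

open Classical in
/-- The indices `i` for which `p` is in the interior of the half-size copy of the convex hull of
the configuration `x` with centre of homothety `x i`. -/
noncomputable def coveringIndices (x : ι → E) (p : E) : Finset ι :=
  Finset.univ.filter fun i => (2 : ℝ) • p - x i ∈ interior (convexHull ℝ (range x))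

theorem mem_coveringIndices {x : ι → E} {p : E} {i : ι} :
    i ∈ coveringIndices x p ↔ (2 : ℝ) • p - x i ∈ interior (convexHull ℝ (range x)) := by
  simp [coveringIndices]

/-- If `p` were interior to both copies of an antipodal pair, `f (2p)` would be greater than `f (x
i) + f (x j)` by the first copy and at most this by the second. -/
theorem card_filter_interior_lt {x : ι → E} {k : ℕ}
    (h : ∀ s : Finset ι, s.card = k → ∃ i ∈ s, ∃ j ∈ s,
      IsAntipodalPair (convexHull ℝ (range x)) (x i) (x j)) (p : E) :
    (coveringIndices x p).card < k := by
  by_contra! hc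
  obtain ⟨s, hs, hcard⟩ := Finset.exists_subset_card_eq hc
  obtain ⟨i, hi, j, hj, f, hf, hfP⟩ := h s hcard
  have hi' := mem_coveringIndices.1 (hs hi)
  have hj' := mem_coveringIndices.1 (hs hj)
  have hf0 : f ≠ 0 := by rintro rfl; simp at hf
  have h1 := lt_of_mem_interior_of_forall_le hf0 (fun p hp => (hfP p hp).1) hi'
  have h2 := (hfP _ (interior_subset hj')).2
  simp only [map_sub] at h1 h2
  linarith

theorem isCompact_convexHull_range (x : ι → E) : IsCompact (convexHull ℝ (range x)) :=
  (finite_range x).isCompact_convexHull ℝ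

variable [FiniteDimensional ℝ E]

theorem addHaar_setOf_two_smul_sub_mem [MeasurableSpace E] [BorelSpace E] (μ : Measure E)
    [μ.IsAddHaarMeasure] (S : Set E) (x : E) :
    μ {p : E | (2 : ℝ) • p - x ∈ S} = μ S / 2 ^ finrank ℝ E := by
  have h : {p : E | (2 : ℝ) • p - x ∈ S} = (fun p : E => (2 : ℝ) • p) ⁻¹' ((fun p => p + -x) ⁻¹' S) := by
    ext p; simp [sub_eq_add_neg]
  rw [h, Measure.addHaar_preimage_smul μ (two_ne_zero), measure_preimage_add_right,
    ENNReal.div_eq_inv_mul]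
  congr 1
  rw [abs_of_nonneg (by positivity), ENNReal.ofReal_inv_of_pos (by positivity)]
  simp

/-- Integrate the covering multiplicity: it is at most `k - 1` everywhere, and on `O` one unit is to
spare, which pays for the term `μ O`. -/
theorem card_mul_measure_interior_add_le [MeasurableSpace E] [BorelSpace E] (μ : Measure E)
    [μ.IsAddHaarMeasure] {x : ι → E} {k : ℕ}
    (h : ∀ s : Finset ι, s.card = k → ∃ i ∈ s, ∃ j ∈ s,
      IsAntipodalPair (convexHull ℝ (range x)) (x i) (x j))
    {O : Set E} (hO : IsOpen O) (hOQ : O ⊆ interior (convexHull ℝ (range x)))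
    (hOk : ∀ p ∈ O, (coveringIndices x p).card + 1 < k) :
    Fintype.card ι * (μ (interior (convexHull ℝ (range x))) / 2 ^ finrank ℝ E) + μ O ≤
      (k - 1 : ℕ) * μ (interior (convexHull ℝ (range x))) := by
  set Q := interior (convexHull ℝ (range x)) with hQ
  have hA : ∀ i, IsOpen {p : E | (2 : ℝ) • p - x i ∈ Q} := fun i =>
    isOpen_interior.preimage (by fun_prop)
  have hAQ : ∀ i, {p : E | (2 : ℝ) • p - x i ∈ Q} ⊆ Q := fun i =>
    subset_interior_setOf_two_smul_sub_mem (convex_convexHull ℝ _)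
      (subset_convexHull ℝ _ (mem_range_self i))
  calc _ = ∫⁻ p, (∑ i, indicator {p : E | (2 : ℝ) • p - x i ∈ Q} 1 p) + indicator O 1 p ∂μ := by
        rw [lintegral_add_right _ (measurable_one.indicator hO.measurableSet),
          lintegral_finsetSum _ fun i _ => measurable_one.indicator (hA i).measurableSet]
        simp only [lintegral_indicator_one hO.measurableSet,
          lintegral_indicator_one (hA _).measurableSet, addHaar_setOf_two_smul_sub_mem]
        simp
    _ ≤ ∫⁻ p, (k - 1 : ℕ) * indicator Q 1 p ∂μ := by
        refine lintegral_mono fun p => ?_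
        by_cases hp : p ∈ Q
        · have hs : (∑ i, indicator {p : E | (2 : ℝ) • p - x i ∈ Q} (1 : E → ENNReal) p) =
              ((coveringIndices x p).card : ENNReal) := by
            classical
            rw [coveringIndices, ← hQ, ← Finset.sum_boole]
            refine Finset.sum_congr rfl fun i _ => ?_
            by_cases hi : (2 : ℝ) • p - x i ∈ Q
            · rw [indicator_of_mem (by exact hi), if_pos hi, Pi.one_apply]
            · rw [indicator_of_notMem (by exact hi), if_neg hi]
          simp only [hs, indicator_of_mem hp, Pi.one_apply, mul_one]
          by_cases hpO : p ∈ O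
          · rw [indicator_of_mem hpO, Pi.one_apply]
            have := hOk p hpO
            exact_mod_cast (by omega : _ + 1 ≤ k - 1)
          · rw [indicator_of_notMem hpO, add_zero]
            have := card_filter_interior_lt h p
            exact_mod_cast (by omega : _ ≤ k - 1)
        · have h1 : ∀ i, indicator {p : E | (2 : ℝ) • p - x i ∈ Q} (1 : E → ENNReal) p = 0 :=
            fun i => indicator_of_notMem (fun hi => hp (hAQ i hi)) _
          have h2 : indicator O (1 : E → ENNReal) p = 0 :=
            indicator_of_notMem (fun hi => hp (hOQ hi)) _
          simp [h1, h2]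
    _ = _ := by
        rw [lintegral_const_mul _ (measurable_one.indicator isOpen_interior.measurableSet),
          lintegral_indicator_one isOpen_interior.measurableSet]

/-- With this many points the volume inequality is tight and leaves no measure for an open set of
points covered at most `k - 2` times. -/
theorem exists_le_card_filter_interior {x : ι → E} {k : ℕ} (hk : 2 ≤ k)
    (hne : (interior (convexHull ℝ (range x))).Nonempty)
    (h : ∀ s : Finset ι, s.card = k → ∃ i ∈ s, ∃ j ∈ s,
      IsAntipodalPair (convexHull ℝ (range x)) (x i) (x j))
    (hcard : Fintype.card ι = (k - 1) * 2 ^ finrank ℝ E) {O : Set E} (hO : IsOpen O)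
    (hOP : (O ∩ convexHull ℝ (range x)).Nonempty) :
    ∃ p ∈ O, k - 1 ≤ (coveringIndices x p).card := by
  let _ : MeasurableSpace E := borel E
  have : BorelSpace E := ⟨rfl⟩
  by_contra! hc
  set P := convexHull ℝ (range x) with hP
  have hne' : (O ∩ interior P).Nonempty := by
    obtain ⟨p, hpO, hpP⟩ := hOP
    have : p ∈ closure (interior P) := by
      rw [(convex_convexHull ℝ _).closure_interior_eq_closure_of_nonempty_interior hne]
      exact subset_closure hpP
    exact mem_closure_iff.1 this O hO hpO
  have hle := card_mul_measure_interior_add_le (Measure.addHaar (G := E)) h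
    (hO.inter isOpen_interior) inter_subset_right
    (fun p hp => by have := hc p hp.1; omega)
  have hpos : 0 < Measure.addHaar (O ∩ interior P) :=
    (hO.inter isOpen_interior).measure_pos _ hne'
  have hfin : Measure.addHaar (interior P) ≠ ⊤ :=
    ((measure_mono interior_subset).trans_lt (isCompact_convexHull_range x).measure_lt_top).ne
  rw [hcard] at hle
  have he : (((k - 1) * 2 ^ finrank ℝ E : ℕ) : ENNReal) *
      (Measure.addHaar (interior P) / 2 ^ finrank ℝ E) = (k - 1 : ℕ) * Measure.addHaar (interior P) := by
    push_cast
    rw [mul_assoc, ENNReal.mul_div_cancel (by positivity) (by simp)]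
  rw [he] at hle
  have hfin' : ((k - 1 : ℕ) : ENNReal) * Measure.addHaar (interior P) ≠ ⊤ :=
    ENNReal.mul_ne_top (by simp) hfin
  have := ENNReal.add_lt_add_left hfin' hpos
  rw [add_zero] at this
  exact absurd hle (not_le.2 this)

theorem card_le_of_nonempty_interior {x : ι → E} {k : ℕ}
    (hne : (interior (convexHull ℝ (range x))).Nonempty)
    (h : ∀ s : Finset ι, s.card = k → ∃ i ∈ s, ∃ j ∈ s,
      IsAntipodalPair (convexHull ℝ (range x)) (x i) (x j)) :
    Fintype.card ι ≤ (k - 1) * 2 ^ finrank ℝ E := by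
  let _ : MeasurableSpace E := borel E
  have : BorelSpace E := ⟨rfl⟩
  have hle := card_mul_measure_interior_add_le (Measure.addHaar (G := E)) h
    isOpen_empty (empty_subset _) (by simp)
  have hpos : Measure.addHaar (interior (convexHull ℝ (range x))) ≠ 0 :=
    (isOpen_interior.measure_pos _ hne).ne'
  have hfin : Measure.addHaar (interior (convexHull ℝ (range x))) ≠ ⊤ :=
    ((measure_mono interior_subset).trans_lt (isCompact_convexHull_range x).measure_lt_top).ne
  rw [measure_empty, add_zero, ← mul_div_assoc, ENNReal.div_le_iff (by positivity) (by simp),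
    mul_right_comm, ENNReal.mul_le_mul_iff_left hpos hfin] at hle
  exact_mod_cast hle

end Counting

/-! ### Reduction to full-dimensional configurations. -/

section Reduction
variable {E : Type*} [NormedAddCommGroup E] [NormedSpace ℝ E]

theorem isAntipodalPair_convexHull {S : Set E} {a b : E} :
    IsAntipodalPair (convexHull ℝ S) a b ↔
      ∃ f : E →ₗ[ℝ] ℝ, f b < f a ∧ ∀ p ∈ S, f b ≤ f p ∧ f p ≤ f a := by
  refine exists_congr fun f => and_congr_right fun _ =>
    ⟨fun h p hp => h p (subset_convexHull ℝ S hp), fun h p hp => ?_⟩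
  have hc : Convex ℝ (f ⁻¹' Icc (f b) (f a)) := (convex_Icc _ _).linear_preimage f
  exact convexHull_min (fun q hq => h q hq) hc hp

variable {ι : Type*} [Fintype ι]

/-- The configuration is full-dimensional in its own span. The exponent is kept as the dimension of
the span so that equality with the ambient bound forces full dimension. -/
theorem card_le_mul_two_pow_finrank_vectorSpan [Nonempty ι] {x : ι → E} {k : ℕ}
    (h : ∀ s : Finset ι, s.card = k → ∃ i ∈ s, ∃ j ∈ s,
      IsAntipodalPair (convexHull ℝ (range x)) (x i) (x j)) :
    Fintype.card ι ≤ (k - 1) * 2 ^ finrank ℝ (vectorSpan ℝ (range x)) := by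
  obtain ⟨i₀⟩ := ‹Nonempty ι›
  set W := vectorSpan ℝ (range x) with hW
  let y : ι → W := fun i => ⟨x i - x i₀,
    vsub_mem_vectorSpan ℝ (mem_range_self i) (mem_range_self i₀)⟩
  let g : W →ᵃ[ℝ] E := W.subtype.toAffineMap + AffineMap.const ℝ W (x i₀)
  have hg : ∀ i, g (y i) = x i := fun i => by simp [g, y]
  have himg : g '' range y = range x := by
    rw [← range_comp]
    exact congrArg range (funext hg)
  have htop : vectorSpan ℝ (range y) = ⊤ := by
    have h1 := AffineMap.map_vectorSpan g (s := range y)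
    rw [himg] at h1
    have hl : g.linear = W.subtype := by ext w; simp [g]
    rw [hl, ← hW] at h1
    apply Submodule.map_injective_of_injective W.injective_subtype
    rw [h1, Submodule.map_subtype_top]
  refine card_le_of_nonempty_interior (x := y) ?_ fun s hs => ?_
  · rw [interior_convexHull_nonempty_iff_affineSpan_eq_top,
      AffineSubspace.affineSpan_eq_top_iff_vectorSpan_eq_top_of_nonempty ℝ W W ⟨_, mem_range_self i₀⟩]
    exact htop
  · obtain ⟨i, hi, j, hj, hij⟩ := h s hs
    obtain ⟨f, hf, hfx⟩ := isAntipodalPair_convexHull.1 hij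
    refine ⟨i, hi, j, hj, isAntipodalPair_convexHull.2 ⟨f ∘ₗ W.subtype, ?_, ?_⟩⟩
    · simpa [y] using hf
    · rintro _ ⟨l, rfl⟩
      simpa [y] using hfx _ (mem_range_self l)

variable [FiniteDimensional ℝ E]

theorem card_le_mul_two_pow_finrank [Nonempty ι] {x : ι → E} {k : ℕ}
    (h : ∀ s : Finset ι, s.card = k → ∃ i ∈ s, ∃ j ∈ s,
      IsAntipodalPair (convexHull ℝ (range x)) (x i) (x j)) :
    Fintype.card ι ≤ (k - 1) * 2 ^ finrank ℝ E :=
  (card_le_mul_two_pow_finrank_vectorSpan h).trans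
    (Nat.mul_le_mul_left _ (Nat.pow_le_pow_right (by norm_num) (Submodule.finrank_le _)))

theorem nonempty_interior_of_card_eq [Nonempty ι] {x : ι → E} {k : ℕ} (hk : 2 ≤ k)
    (h : ∀ s : Finset ι, s.card = k → ∃ i ∈ s, ∃ j ∈ s,
      IsAntipodalPair (convexHull ℝ (range x)) (x i) (x j))
    (hcard : Fintype.card ι = (k - 1) * 2 ^ finrank ℝ E) :
    (interior (convexHull ℝ (range x))).Nonempty := by
  have h1 := card_le_mul_two_pow_finrank_vectorSpan h
  rw [hcard] at h1
  have h2 := (Nat.pow_le_pow_iff_right (by norm_num)).1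
    (Nat.le_of_mul_le_mul_left h1 (by omega : 0 < k - 1))
  rw [interior_convexHull_nonempty_iff_affineSpan_eq_top,
    AffineSubspace.affineSpan_eq_top_iff_vectorSpan_eq_top_of_nonempty ℝ E E (range_nonempty x)]
  exact Submodule.eq_top_of_finrank_eq (le_antisymm (Submodule.finrank_le _) h2)

end Reduction

/-! ### Multiplicities and extreme points of an extremal configuration. -/

section Extremal
/-- If a point `v` has multiplicity `k - 1` and any `k` points contain a related pair, then every
point other than `v` is related to `v`. -/
theorem rel_of_card_filter_eq {E ι : Type*} [Fintype ι] [DecidableEq E] {x : ι → E} {k : ℕ} (hk : 2 ≤ k)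
    {R : E → E → Prop} (hsymm : ∀ {a b}, R a b → R b a) (hirr : ∀ {a b}, R a b → a ≠ b)
    (h : ∀ s : Finset ι, s.card = k → ∃ i ∈ s, ∃ j ∈ s, R (x i) (x j)) {v : E}
    (hv : (Finset.univ.filter fun i => x i = v).card = k - 1) {l : ι} (hl : x l ≠ v) :
    R (x l) v := by
  classical
  -- The `k - 1` indices at `v` and the index `l` form a set of `k`; irreflexivity leaves only pairs
  -- joining `x l` and `v`.
  obtain ⟨i, hi, j, hj, hij⟩ := h (insert l (Finset.univ.filter fun i => x i = v)) (by
    rw [Finset.card_insert_of_notMem (by simpa using hl), hv]; omega)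
  have hne := hirr hij
  simp only [Finset.mem_insert, Finset.mem_filter, Finset.mem_univ, true_and] at hi hj
  rcases hi with rfl | hi <;> rcases hj with rfl | hj
  · exact absurd rfl hne
  · rwa [hj] at hij
  · rw [hi] at hij
    exact hsymm hij
  · exact absurd (hi.trans hj.symm) hne

variable {E : Type*} [NormedAddCommGroup E] [NormedSpace ℝ E] {ι : Type*} [Fintype ι]

theorem convexHull_extremePoints_convexHull_range [FiniteDimensional ℝ E] (x : ι → E) :
    convexHull ℝ (extremePoints ℝ (convexHull ℝ (range x))) = convexHull ℝ (range x) := by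
  have h := closure_convexHull_extremePoints (isCompact_convexHull_range x)
    (convex_convexHull ℝ (range x))
  have hfin : (extremePoints ℝ (convexHull ℝ (range x))).Finite :=
    (finite_range x).subset extremePoints_convexHull_subset
  rwa [(hfin.isCompact_convexHull ℝ).isClosed.closure_eq] at h

/-- A point that is antipodal to every other extreme point of a convex hull is itself extreme. -/
theorem mem_of_forall_isAntipodalPair {V : Set E} {y : E} (hy : y ∈ convexHull ℝ V)
    (h : ∀ v ∈ V, y ≠ v → IsAntipodalPair (convexHull ℝ V) y v) : y ∈ V := by
  rw [convexHull_eq] at hy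
  obtain ⟨κ, t, w, z, hw0, hw1, hz, hyz⟩ := hy
  by_contra hyV
  -- A functional that is maximal at `y` and strictly smaller at one vertex of positive weight has
  -- an average below `f y`.
  obtain ⟨i, hi, hwi⟩ : ∃ i ∈ t, 0 < w i := by
    by_contra! hc
    have := Finset.sum_nonpos hc
    linarith
  obtain ⟨f, hf, hfP⟩ := h (z i) (hz i hi) (fun he => hyV (he ▸ hz i hi))
  have h1 : f y = ∑ j ∈ t, w j * f (z j) := by
    rw [← hyz, Finset.centerMass_eq_of_sum_1 _ _ hw1]
    simp
  have h2 : ∑ j ∈ t, w j * f (z j) < ∑ j ∈ t, w j * f y :=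
    Finset.sum_lt_sum (fun j hj => mul_le_mul_of_nonneg_left
      (hfP _ (subset_convexHull ℝ V (hz j hj))).2 (hw0 j hj))
      ⟨i, hi, mul_lt_mul_of_pos_left hf hwi⟩
  rw [← Finset.sum_mul, hw1, one_mul] at h2
  linarith

theorem card_filter_eq_lt [DecidableEq E] {x : ι → E} {k : ℕ} {P : Set E}
    (h : ∀ s : Finset ι, s.card = k → ∃ i ∈ s, ∃ j ∈ s, IsAntipodalPair P (x i) (x j)) (v : E) :
    (Finset.univ.filter fun i => x i = v).card < k := by
  by_contra! hc
  obtain ⟨s, hs, hcard⟩ := Finset.exists_subset_card_eq hc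
  obtain ⟨i, hi, j, hj, hij⟩ := h s hcard
  exact hij.ne ((Finset.mem_filter.1 (hs hi)).2.trans (Finset.mem_filter.1 (hs hj)).2.symm)

theorem isAntipodalPair_of_card_filter_eq [DecidableEq E] {x : ι → E} {k : ℕ} (hk : 2 ≤ k)
    {P : Set E}
    (h : ∀ s : Finset ι, s.card = k → ∃ i ∈ s, ∃ j ∈ s, IsAntipodalPair P (x i) (x j)) {v : E}
    (hv : (Finset.univ.filter fun i => x i = v).card = k - 1) {l : ι} (hl : x l ≠ v) :
    IsAntipodalPair P (x l) v :=
  rel_of_card_filter_eq hk IsAntipodalPair.symm IsAntipodalPair.ne h hv hl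

theorem two_smul_sub_notMem_of_mem_extremePoints {P : Set E} {v a : E}
    (hv : v ∈ extremePoints ℝ P) (ha : a ∈ P) (hne : a ≠ v) : (2 : ℝ) • v - a ∉ P := by
  intro h
  refine hne (hv.2 ha h ⟨1 / 2, 1 / 2, by norm_num, by norm_num, by norm_num, ?_⟩)
  module

variable [FiniteDimensional ℝ E]

/-- An extreme point `v` has a neighbourhood missed by all copies with centre other than `v`, and it
contains a point covered `k - 1` times. -/
theorem card_filter_eq_of_mem_extremePoints [DecidableEq E] {x : ι → E} {k : ℕ} (hk : 2 ≤ k)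
    (hne : (interior (convexHull ℝ (range x))).Nonempty)
    (h : ∀ s : Finset ι, s.card = k → ∃ i ∈ s, ∃ j ∈ s,
      IsAntipodalPair (convexHull ℝ (range x)) (x i) (x j))
    (hcard : Fintype.card ι = (k - 1) * 2 ^ finrank ℝ E) {v : E}
    (hv : v ∈ extremePoints ℝ (convexHull ℝ (range x))) :
    (Finset.univ.filter fun i => x i = v).card = k - 1 := by
  refine le_antisymm (by have := card_filter_eq_lt h v; omega) ?_
  set P := convexHull ℝ (range x) with hP
  have hcl : IsClosed P := (isCompact_convexHull_range x).isClosed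
  have hmem : ∀ i, x i ∈ P := fun i => subset_convexHull ℝ _ (mem_range_self i)
  obtain ⟨p, hp, hpk⟩ := exists_le_card_filter_interior hk hne h hcard
    (O := ⋂ i ∈ {i | x i ≠ v}, {p : E | (2 : ℝ) • p - x i ∈ Pᶜ})
    ((toFinite _).isOpen_biInter fun i _ => hcl.isOpen_compl.preimage (by fun_prop))
    ⟨v, by
      simp only [mem_iInter]
      exact fun i hi => two_smul_sub_notMem_of_mem_extremePoints hv (hmem i) hi, hv.1⟩
  refine hpk.trans (Finset.card_le_card fun i hi => ?_)
  rw [mem_coveringIndices] at hi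
  simp only [mem_iInter] at hp
  by_contra hc
  exact hp i (by simpa using hc) (interior_subset hi)

theorem range_eq_extremePoints {x : ι → E} {k : ℕ} (hk : 2 ≤ k)
    (hne : (interior (convexHull ℝ (range x))).Nonempty)
    (h : ∀ s : Finset ι, s.card = k → ∃ i ∈ s, ∃ j ∈ s,
      IsAntipodalPair (convexHull ℝ (range x)) (x i) (x j))
    (hcard : Fintype.card ι = (k - 1) * 2 ^ finrank ℝ E) :
    range x = extremePoints ℝ (convexHull ℝ (range x)) := by
  classical
  refine Subset.antisymm ?_ extremePoints_convexHull_subset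
  rintro _ ⟨l, rfl⟩
  apply mem_of_forall_isAntipodalPair
  · rw [convexHull_extremePoints_convexHull_range]
    exact subset_convexHull ℝ _ (mem_range_self l)
  · intro v hv hlv
    rw [convexHull_extremePoints_convexHull_range]
    exact isAntipodalPair_of_card_filter_eq hk h
      (card_filter_eq_of_mem_extremePoints hk hne h hcard hv) hlv

/-- The closed copies are finitely many, so a point missed by all has a neighbourhood missed by all,
against the density of points covered `k - 1 ≥ 1` times. -/
theorem exists_two_smul_sub_mem {x : ι → E} {k : ℕ} (hk : 2 ≤ k)
    (hne : (interior (convexHull ℝ (range x))).Nonempty)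
    (h : ∀ s : Finset ι, s.card = k → ∃ i ∈ s, ∃ j ∈ s,
      IsAntipodalPair (convexHull ℝ (range x)) (x i) (x j))
    (hcard : Fintype.card ι = (k - 1) * 2 ^ finrank ℝ E) {p : E}
    (hp : p ∈ convexHull ℝ (range x)) :
    ∃ v ∈ range x, (2 : ℝ) • p - v ∈ convexHull ℝ (range x) := by
  by_contra! hc
  have hcl : IsClosed (convexHull ℝ (range x)) := (isCompact_convexHull_range x).isClosed
  obtain ⟨q, hq, hqk⟩ := exists_le_card_filter_interior hk hne h hcard
    (O := ⋂ i, {p : E | (2 : ℝ) • p - x i ∈ (convexHull ℝ (range x))ᶜ})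
    (isOpen_iInter_of_finite fun i => hcl.isOpen_compl.preimage (by fun_prop))
    ⟨p, by
      simp only [mem_iInter]
      exact fun i => hc _ (mem_range_self i), hp⟩
  obtain ⟨i, hi⟩ := Finset.card_pos.1 (by omega : 0 < (coveringIndices x q).card)
  rw [mem_coveringIndices] at hi
  exact mem_iInter.1 hq i (interior_subset hi)

/-- An extremal configuration consists of `2 ^ d` points of multiplicity `k - 1`. -/
theorem card_filter_eq_and_ncard_range {x : ι → E} [DecidableEq E] {k : ℕ} (hk : 2 ≤ k)
    (hne : (interior (convexHull ℝ (range x))).Nonempty)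
    (h : ∀ s : Finset ι, s.card = k → ∃ i ∈ s, ∃ j ∈ s,
      IsAntipodalPair (convexHull ℝ (range x)) (x i) (x j))
    (hcard : Fintype.card ι = (k - 1) * 2 ^ finrank ℝ E) :
    (∀ v ∈ range x, (Finset.univ.filter fun i => x i = v).card = k - 1) ∧
      (range x).ncard = 2 ^ finrank ℝ E := by
  have h1 : ∀ v ∈ range x, (Finset.univ.filter fun i => x i = v).card = k - 1 := fun v hv =>
    card_filter_eq_of_mem_extremePoints hk hne h hcard
      (range_eq_extremePoints hk hne h hcard ▸ hv)
  refine ⟨h1, ?_⟩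
  have h2 : Fintype.card ι = ∑ v ∈ Finset.univ.image x,
      (Finset.univ.filter fun i => x i = v).card :=
    Finset.card_eq_sum_card_image x Finset.univ
  rw [Finset.sum_congr rfl (fun v hv => h1 v (by simpa using hv)), Finset.sum_const, smul_eq_mul,
    hcard, mul_comm] at h2
  have h3 : (Finset.univ.image x).card = 2 ^ finrank ℝ E :=
    (Nat.eq_of_mul_eq_mul_right (by omega : 0 < k - 1) h2).symm
  rw [← h3, ← ncard_coe_finset]
  simp

end Extremal

/-! ### Tilings by translates: generic lines and covering bounds. -/

section Cube
variable {E : Type*} [NormedAddCommGroup E] [NormedSpace ℝ E]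

theorem mem_convexHull_setOf_eq {V : Set E} {f : E →ₗ[ℝ] ℝ} {M : ℝ} (h : ∀ v ∈ V, f v ≤ M) {p : E}
    (hp : p ∈ convexHull ℝ V) (hfp : f p = M) : p ∈ convexHull ℝ {v ∈ V | f v = M} := by
  rw [convexHull_eq] at hp
  obtain ⟨κ, t, w, z, hw0, hw1, hz, hpz⟩ := hp
  have h1 : f p = ∑ j ∈ t, w j * f (z j) := by
    rw [← hpz, Finset.centerMass_eq_of_sum_1 _ _ hw1]
    simp
  have h2 : ∀ j ∈ t, w j * f (z j) ≤ w j * M := fun j hj =>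
    mul_le_mul_of_nonneg_left (h _ (hz j hj)) (hw0 j hj)
  have h3 : ∀ j ∈ t, w j * f (z j) = w j * M := by
    refine (Finset.sum_eq_sum_iff_of_le h2).1 ?_
    rw [← h1, hfp, ← Finset.sum_mul, hw1, one_mul]
  rw [← hpz, ← Finset.centerMass_filter_ne_zero]
  refine Finset.centerMass_mem_convexHull _ (fun i hi => hw0 i (Finset.mem_filter.1 hi).1) ?_ ?_
  · rw [Finset.sum_filter_ne_zero, hw1]; exact one_pos
  · intro i hi
    obtain ⟨hit, hi0⟩ := Finset.mem_filter.1 hi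
    exact ⟨hz i hit, mul_left_cancel₀ hi0 (h3 i hit)⟩

theorem sub_mem_vectorSpan_of_mem_convexHull {S : Set E} {p s : E} (hp : p ∈ convexHull ℝ S)
    (hs : s ∈ S) : p - s ∈ vectorSpan ℝ S := by
  rw [← direction_affineSpan]
  exact AffineSubspace.vsub_mem_direction (convexHull_subset_affineSpan S hp)
    (subset_affineSpan ℝ S hs)

/-- A line that leaves the tile `P + v` inside `2 P` meets a further tile `P + w`. -/
theorem exists_mem_inter_translates {V P : Set E} (hV : V.Finite) (hP : IsCompact P)
    (hPc : Convex ℝ P) (hcov : ∀ p ∈ P, ∃ v ∈ V, (2 : ℝ) • p - v ∈ P) {c u v : E} {β : ℝ}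
    (hβ : 0 ≤ β) (hc : c ∈ P) (hcu : c + β • u ∈ P) (hv : (2 : ℝ) • c - v ∈ P)
    (hvu : (2 : ℝ) • c - v + (2 * β) • u ∉ P) :
    ∃ t : ℝ, ∃ w ∈ V, w ≠ v ∧ (2 : ℝ) • c + t • u - v ∈ P ∧ (2 : ℝ) • c + t • u - w ∈ P := by
  have hcont : ∀ w : E, Continuous fun t : ℝ => (2 : ℝ) • c + t • u - w := fun w => by fun_prop
  -- The last parameter in the tile of `v` is the one wanted. If no other tile contained that point,
  -- none would contain the points just beyond it, and these would again have to be covered by the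
  -- tile of `v`.
  set T : Set ℝ := Icc 0 (2 * β) ∩ (fun t : ℝ => (2 : ℝ) • c + t • u - v) ⁻¹' P with hT
  have hTc : IsCompact T := isCompact_Icc.inter_right (hP.isClosed.preimage (hcont v))
  obtain ⟨t, ⟨⟨ht0, htβ⟩, htP⟩, htm⟩ := hTc.exists_isGreatest
    ⟨0, ⟨le_rfl, by positivity⟩, by simpa using hv⟩
  have htlt : t < 2 * β := by
    refine lt_of_le_of_ne htβ ?_
    rintro rfl
    exact hvu (by convert show _ ∈ P from htP using 1; module)
  refine ⟨t, ?_⟩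
  by_contra! hno
  have hev : ∀ᶠ s in nhds t, ∀ w ∈ V, w ≠ v → (2 : ℝ) • c + s • u - w ∉ P := by
    rw [hV.eventually_all]
    intro w hw
    rcases eq_or_ne w v with rfl | hne
    · simp
    · filter_upwards [(hcont w).continuousAt.eventually_mem
        (hP.isClosed.isOpen_compl.mem_nhds (hno w hw hne htP))] with s hs _
      exact hs
  obtain ⟨s, hs, hts, hsβ⟩ := ((hev.filter_mono nhdsWithin_le_nhds).and
    (Ioo_mem_nhdsGT htlt)).exists
  have hsc : c + (s / 2) • u ∈ P := by
    have h0 : 0 ≤ s := ht0.trans hts.le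
    have hβ0 : 0 < β := by linarith
    have h := hPc hc hcu (a := 1 - s / (2 * β)) (b := s / (2 * β))
      (by rw [sub_nonneg, div_le_one (by positivity)]; exact hsβ.le) (by positivity) (by ring)
    convert h using 1
    have : s / 2 = s / (2 * β) * β := by field_simp
    rw [this]
    module
  obtain ⟨w, hw, hwP⟩ := hcov _ hsc
  have he : (2 : ℝ) • (c + (s / 2) • u) - w = (2 : ℝ) • c + s • u - w := by module
  rw [he] at hwP
  rcases eq_or_ne w v with rfl | hne
  · exact hts.not_ge (htm ⟨⟨ht0.trans hts.le, hsβ.le⟩, hwP⟩)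
  · exact hs w hw hne hwP

/-- In every direction there is a line whose part in `2 P` is longer than every chord of `P`. -/
theorem exists_isOpen_long_chord {P : Set E} (hP : IsCompact P) (hPc : Convex ℝ P)
    (hne : (interior P).Nonempty) {u : E} (hu : u ≠ 0) :
    ∃ β : ℝ, 0 < β ∧ (∃ c, c + β • u ∈ interior P ∧ c - β • u ∈ interior P) ∧
      ∀ x ∈ P, x + (4 * β) • u ∉ P := by
  set T : Set ℝ := {t | ∃ x ∈ P, x + t • u ∈ P} with hT
  have hbdd : BddAbove T := by
    obtain ⟨R, hR⟩ := hP.isBounded.exists_norm_le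
    refine ⟨2 * R / ‖u‖, ?_⟩
    rintro t ⟨x, hx, hxt⟩
    rw [le_div_iff₀ (norm_pos_iff.2 hu)]
    have h1 : ‖t • u‖ ≤ ‖x + t • u‖ + ‖x‖ := by
      simpa using norm_sub_le (x + t • u) x
    rw [norm_smul] at h1
    nlinarith [hR _ hx, hR _ hxt, le_abs_self t, Real.norm_eq_abs t, norm_nonneg u]
  obtain ⟨o, ho⟩ := hne
  obtain ⟨t₁, ht₁, ht₁P⟩ : ∃ t₁ : ℝ, 0 < t₁ ∧ t₁ ∈ T := by
    have hc : Continuous fun t : ℝ => o + t • u := by fun_prop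
    have hev : ∀ᶠ t in nhds (0 : ℝ), o + t • u ∈ interior P :=
      hc.continuousAt.eventually_mem (isOpen_interior.mem_nhds (by simpa using ho))
    obtain ⟨t, ht, ht0⟩ := ((hev.filter_mono nhdsWithin_le_nhds).and
      (self_mem_nhdsWithin (s := Ioi (0 : ℝ)))).exists
    exact ⟨t, ht0, o, interior_subset ho, interior_subset ht⟩
  have hpos : 0 < sSup T := ht₁.trans_le (le_csSup hbdd ht₁P)
  obtain ⟨t, ⟨x, hx, hxt⟩, ht⟩ := exists_lt_of_lt_csSup ⟨t₁, ht₁P⟩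
    (by linarith : 2 / 3 * sSup T < sSup T)
  -- Shrinking a chord of length parameter `t` by 3/4 towards `o` makes its ends interior. It then
  -- has half-length `3t/8`, and `4 * (3t/8) = 3t/2` exceeds the supremum because `t > 2/3 * sSup
  -- T`.
  refine ⟨3 / 8 * t, by linarith, ⟨(1 / 4 : ℝ) • o + (3 / 4 : ℝ) • (x + (t / 2) • u), ?_, ?_⟩, ?_⟩
  · convert hPc.combo_interior_self_mem_interior ho hxt (a := 1 / 4) (b := 3 / 4) (by norm_num)
      (by norm_num) (by norm_num) using 1
    module
  · convert hPc.combo_interior_self_mem_interior ho hx (a := 1 / 4) (b := 3 / 4) (by norm_num)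
      (by norm_num) (by norm_num) using 1
    module
  · intro y hy hyt
    have := le_csSup hbdd (show 4 * (3 / 8 * t) ∈ T from ⟨y, hy, hyt⟩)
    linarith

variable [FiniteDimensional ℝ E]

/-- The set of centres for which a line of direction `u` meets the pieces of the tiling in
general position is dense. -/
theorem dense_setOf_generic {V P : Set E} (hV : V.Finite) (hPc : Convex ℝ P) (u : E) :
    Dense {c : E | ∀ v ∈ V, (2 : ℝ) • c - v ∉ frontier P ∧ ∀ S ⊆ V, ∀ s ∈ V,
      vectorSpan ℝ S ⊔ Submodule.span ℝ {u} ≠ ⊤ →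
        (2 : ℝ) • c - (v + s) ∉ vectorSpan ℝ S ⊔ Submodule.span ℝ {u}} := by
  let _ : MeasurableSpace E := borel E
  have : BorelSpace E := ⟨rfl⟩
  -- The excluded centres form a finite union of null sets: preimages of the frontier of a convex
  -- set and of proper subspaces.
  have key : ∀ (Z : Set E) (a : E), Measure.addHaar (G := E) Z = 0 →
      ∀ᵐ c ∂(Measure.addHaar : Measure E), (2 : ℝ) • c - a ∉ Z := fun Z a hZ => by
    rw [ae_iff]
    simp only [not_not]
    rw [addHaar_setOf_two_smul_sub_mem, hZ, ENNReal.zero_div]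
  refine Measure.dense_of_ae (μ := (Measure.addHaar : Measure E)) ?_
  rw [ae_ball_iff hV.countable]
  intro v _
  refine (key _ v (hPc.addHaar_frontier _)).and ?_
  refine (ae_ball_iff hV.finite_subsets.countable).2 ?_
  intro S _
  rw [ae_ball_iff hV.countable]
  intro s _
  by_cases h : vectorSpan ℝ S ⊔ Submodule.span ℝ {u} = ⊤
  · simp [h]
  · filter_upwards [key _ (v + s) (Measure.addHaar_submodule _ _ h)] with c hc _ using hc

/-- Half-size copies with centres in `S` that cover `conv S` are at least `2 ^ d` many, where `d`
is the dimension of `conv S`; here `d` is one less than the dimension of the space. -/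
theorem two_pow_finrank_le_of_cover {S : Set E} (hS : S.Finite) (hSne : S.Nonempty) {u : E}
    (htop : vectorSpan ℝ S ⊔ Submodule.span ℝ {u} = ⊤)
    (hcov : ∀ p ∈ convexHull ℝ S, ∃ v ∈ S, (2 : ℝ) • p - v ∈ convexHull ℝ S) :
    2 ^ finrank ℝ E ≤ 2 * S.ncard := by
  let _ : MeasurableSpace E := borel E
  have : BorelSpace E := ⟨rfl⟩
  let μ : Measure E := Measure.addHaar
  -- The prism over `conv S` in direction `u` has positive volume and is covered by half-size copies
  -- with centres in `S + {0, u}`, at most `2 * S.ncard` in number.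
  set F := convexHull ℝ (S + {0, u}) with hF
  have hFe : F = convexHull ℝ S + segment ℝ 0 u := by
    rw [hF, convexHull_add, convexHull_pair]
  have hfin : (S + {0, u} : Set E).Finite := hS.add (toFinite _)
  have hcomp : IsCompact F := hfin.isCompact_convexHull ℝ
  have hspan : vectorSpan ℝ (S + {0, u} : Set E) = ⊤ := by
    obtain ⟨s, hs⟩ := hSne
    have h0 : s + 0 ∈ (S + {0, u} : Set E) := add_mem_add hs (by simp)
    have h1 : s + u ∈ (S + {0, u} : Set E) := add_mem_add hs (by simp)
    rw [eq_top_iff, ← htop, sup_le_iff, Submodule.span_singleton_le_iff_mem]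
    refine ⟨vectorSpan_mono ℝ fun v hv => ?_, ?_⟩
    · simpa using add_mem_add hv (show (0 : E) ∈ ({0, u} : Set E) by simp)
    · simpa using vsub_mem_vectorSpan ℝ h1 h0
  have hint : (interior F).Nonempty := by
    rw [hF, interior_convexHull_nonempty_iff_affineSpan_eq_top,
      AffineSubspace.affineSpan_eq_top_iff_vectorSpan_eq_top_of_nonempty ℝ E E
        (hSne.add ⟨0, by simp⟩)]
    exact hspan
  have hpos : μ F ≠ 0 :=
    ((isOpen_interior.measure_pos μ hint).trans_le (measure_mono interior_subset)).ne'
  have hlt : μ F ≠ ⊤ := hcomp.measure_lt_top.ne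
  have hsub : F ⊆ ⋃ v ∈ hfin.toFinset, {p : E | (2 : ℝ) • p - v ∈ F} := by
    intro p hp
    rw [hFe] at hp
    obtain ⟨q, hq, r, hr, rfl⟩ := hp
    obtain ⟨v, hv, hvq⟩ := hcov q hq
    rw [segment_eq_image] at hr
    obtain ⟨θ, ⟨hθ0, hθ1⟩, rfl⟩ := hr
    simp only [smul_zero, zero_add, mem_iUnion, Finite.mem_toFinset, exists_prop, mem_ofPred_eq]
    rcases le_total θ (1 / 2) with h | h
    · refine ⟨v + 0, add_mem_add hv (by simp), ?_⟩
      rw [hFe]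
      refine ⟨_, hvq, (2 * θ) • u, ?_, by simp only; module⟩
      rw [segment_eq_image]
      exact ⟨2 * θ, ⟨by linarith, by linarith⟩, by simp⟩
    · refine ⟨v + u, add_mem_add hv (by simp), ?_⟩
      rw [hFe]
      refine ⟨_, hvq, (2 * θ - 1) • u, ?_, by simp only; module⟩
      rw [segment_eq_image]
      exact ⟨2 * θ - 1, ⟨by linarith, by linarith⟩, by simp⟩
  have hle : μ F ≤ hfin.toFinset.card * (μ F / 2 ^ finrank ℝ E) := by
    refine (measure_mono hsub).trans ((measure_biUnion_finset_le _ _).trans ?_)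
    simp only [addHaar_setOf_two_smul_sub_mem]
    simp
  rw [← mul_div_assoc, ENNReal.le_div_iff_mul_le (by simp) (by simp), mul_comm,
    ENNReal.mul_le_mul_iff_left hpos hlt] at hle
  have hle' : 2 ^ finrank ℝ E ≤ hfin.toFinset.card := by exact_mod_cast hle
  rw [← ncard_eq_toFinset_card _ hfin] at hle'
  have hadd : (S + {0, u} : Set E).ncard ≤ S.ncard * ({0, u} : Set E).ncard := by
    rw [← image2_add, ← image_prod, ← ncard_prod]
    exact ncard_image_le (hS.prod (toFinite _))
  have hpair : ({0, u} : Set E).ncard ≤ 2 := by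
    have := ncard_insert_le (0 : E) {u}
    simpa using this
  calc _ ≤ _ := hle'
    _ ≤ _ := hadd
    _ ≤ S.ncard * 2 := Nat.mul_le_mul_left _ hpair
    _ = _ := mul_comm _ _

end Cube

/-! ### Pairs of opposite facets and cube coordinates. -/

section Cube
variable {E : Type*} [NormedAddCommGroup E] [NormedSpace ℝ E]

/-- The values of `f` at `v` and `2p - v` are at most `M` and add up to `2M`, so both points lie in
the face. -/
theorem exists_two_smul_sub_mem_face {V : Set E}
    (hcov : ∀ p ∈ convexHull ℝ V, ∃ v ∈ V, (2 : ℝ) • p - v ∈ convexHull ℝ V) {f : E →ₗ[ℝ] ℝ}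
    {M : ℝ} (hM : ∀ v ∈ V, f v ≤ M) {p : E} (hp : p ∈ convexHull ℝ {z ∈ V | f z = M}) :
    ∃ v ∈ {z ∈ V | f z = M}, (2 : ℝ) • p - v ∈ convexHull ℝ {z ∈ V | f z = M} := by
  obtain ⟨v, hv, hvp⟩ := hcov p (convexHull_mono (sep_subset _ _) hp)
  have hfp : f p = M := by
    have hc : Convex ℝ (f ⁻¹' {M}) := (convex_singleton M).linear_preimage f
    exact convexHull_min (fun z hz => hz.2) hc hp
  have hc : Convex ℝ (f ⁻¹' Iic M) := (convex_Iic M).linear_preimage f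
  have h1 : f ((2 : ℝ) • p - v) ≤ M := convexHull_min (fun z hz => hM z hz) hc hvp
  have h2 := hM v hv
  simp only [map_sub, map_smul, smul_eq_mul] at h1
  exact ⟨v, ⟨hv, by linarith⟩, mem_convexHull_setOf_eq hM hvp (by
    simp only [map_sub, map_smul, smul_eq_mul]; linarith)⟩

variable [FiniteDimensional ℝ E]

/-- Two antipodal points whose two supporting hyperplanes both contain facets. -/
theorem exists_facet_pair {V : Set E} (hV : V.Finite) (hne : (interior (convexHull ℝ V)).Nonempty)
    (hcov : ∀ p ∈ convexHull ℝ V, ∃ v ∈ V, (2 : ℝ) • p - v ∈ convexHull ℝ V)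
    (hanti : ∀ v ∈ V, ∀ w ∈ V, v ≠ w → IsAntipodalPair (convexHull ℝ V) v w) {u : E}
    (hu : u ≠ 0) :
    ∃ v ∈ V, ∃ w ∈ V, ∃ f : E →ₗ[ℝ] ℝ, f v < f w ∧ (∀ z ∈ V, f v ≤ f z ∧ f z ≤ f w) ∧ f u ≠ 0 ∧
      vectorSpan ℝ {z ∈ V | f z = f v} ⊔ Submodule.span ℝ {u} = ⊤ ∧
      vectorSpan ℝ {z ∈ V | f z = f w} ⊔ Submodule.span ℝ {u} = ⊤ := by
  set P := convexHull ℝ V with hP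
  have hPc : Convex ℝ P := convex_convexHull ℝ V
  have hPk : IsCompact P := hV.isCompact_convexHull ℝ
  obtain ⟨β, hβ, ⟨c₀, hc₀⟩, hlong⟩ := exists_isOpen_long_chord hPk hPc hne hu
  have hO : IsOpen {c : E | c + β • u ∈ interior P ∧ c - β • u ∈ interior P} :=
    (isOpen_interior.preimage (by fun_prop)).inter (isOpen_interior.preimage (by fun_prop))
  obtain ⟨c, ⟨hc₁, hc₂⟩, hgen⟩ := (dense_setOf_generic hV hPc u).inter_open_nonempty _ hO ⟨c₀, hc₀⟩
  have hc : c ∈ P := by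
    convert hPc (interior_subset hc₁) (interior_subset hc₂) (a := 1 / 2) (b := 1 / 2)
      (by norm_num) (by norm_num) (by norm_num) using 1
    module
  obtain ⟨v, hv, hvP⟩ := hcov c hc
  have hvint : (2 : ℝ) • c - v ∈ interior P := by
    by_contra h
    exact (hgen v hv).1 ⟨subset_closure hvP, h⟩
  obtain ⟨t, w, hw, hwv, hqv, hqw⟩ : ∃ t : ℝ, ∃ w ∈ V, w ≠ v ∧ (2 : ℝ) • c + t • u - v ∈ P ∧
      (2 : ℝ) • c + t • u - w ∈ P := by
    -- The points `2c ± 2βu` are too far apart for a chord of one tile, so the line leaves `P + v`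
    -- in one of the two directions.
    by_cases h : (2 : ℝ) • c - v + (2 * β) • u ∈ P
    · have h' : (2 : ℝ) • c - v + (2 * β) • (-u) ∉ P := fun h' => hlong _ h' (by
        convert h using 1; module)
      obtain ⟨t, w, hw, hwv, h1, h2⟩ := exists_mem_inter_translates hV hPk hPc hcov hβ.le hc
        (by simpa [sub_eq_add_neg] using interior_subset hc₂) hvP h'
      exact ⟨-t, w, hw, hwv, by simpa using h1, by simpa using h2⟩
    · exact exists_mem_inter_translates hV hPk hPc hcov hβ.le hc (interior_subset hc₁) hvP h
  obtain ⟨f, hf, hfP⟩ := hanti w hw v hv hwv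
  have hf0 : -f ≠ 0 := by
    intro h
    rw [neg_eq_zero] at h
    simp [h] at hf
  -- For the common point `q` of the two tiles, `h1` and `h2` give `f q = f v + f w`, provided that
  -- `f v ≤ f (q - w)` and `f (q - v) ≤ f w` are both sharp, as they must be. So `q - v` and `q - w`
  -- lie in opposite faces, while `h3` excludes `f u = 0`.
  have h1 := (hfP _ hqv).2
  have h2 := (hfP _ hqw).1
  have h3 := lt_of_mem_interior_of_forall_le (f := -f) (m := -f w) hf0
    (fun p hp => by simpa using (hfP p hp).2) hvint
  simp only [map_sub, map_add, map_smul, smul_eq_mul, LinearMap.neg_apply] at h1 h2 h3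
  have hfV : ∀ z ∈ V, f v ≤ f z ∧ f z ≤ f w := fun z hz => hfP z (subset_convexHull ℝ V hz)
  -- If the face and `u` did not span, `2c - (a + b)` would lie in a proper subspace excluded by the
  -- choice of `c`.
  have hspan : ∀ a ∈ V, ∀ b ∈ V, (2 : ℝ) • c + t • u - a ∈ convexHull ℝ {z ∈ V | f z = f b} →
      vectorSpan ℝ {z ∈ V | f z = f b} ⊔ Submodule.span ℝ {u} = ⊤ := by
    intro a ha b hb hab
    by_contra hcon
    refine (hgen a ha).2 _ (sep_subset _ _) b hb hcon ?_
    rw [Submodule.mem_sup]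
    refine ⟨_, sub_mem_vectorSpan_of_mem_convexHull hab ⟨hb, rfl⟩, (-t) • u,
      Submodule.smul_mem _ _ (Submodule.mem_span_singleton_self u), ?_⟩
    module
  refine ⟨v, hv, w, hw, f, hf, hfV, fun h => ?_, hspan w hw v hv ?_, hspan v hv w hw ?_⟩
  · rw [h] at h1 h2
    linarith
  · have := mem_convexHull_setOf_eq (f := -f) (M := -f v)
      (fun z hz => by simpa using (hfV z hz).1) hqw (by
        simp only [map_sub, map_add, map_smul, smul_eq_mul, LinearMap.neg_apply]
        linarith)
    simpa using this
  · exact mem_convexHull_setOf_eq (fun z hz => (hfV z hz).2) hqv (by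
      simp only [map_sub, map_add, map_smul, smul_eq_mul]
      linarith)

theorem two_pow_finrank_le_of_facet {V : Set E} (hV : V.Finite)
    (hcov : ∀ p ∈ convexHull ℝ V, ∃ v ∈ V, (2 : ℝ) • p - v ∈ convexHull ℝ V) {f : E →ₗ[ℝ] ℝ}
    {w u : E} (hw : w ∈ V) (hmax : ∀ v ∈ V, f v ≤ f w)
    (hspan : vectorSpan ℝ {z ∈ V | f z = f w} ⊔ Submodule.span ℝ {u} = ⊤) :
    2 ^ finrank ℝ E ≤ 2 * {z ∈ V | f z = f w}.ncard :=
  two_pow_finrank_le_of_cover (hV.subset (sep_subset _ _)) ⟨w, hw, rfl⟩ hspan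
    fun _ hp => exists_two_smul_sub_mem_face hcov hmax hp

/-- Each of two disjoint opposite facets holds at least half of the `2 ^ d` points, so together they
are all of `V`; rescaling puts the two values at distance 1. -/
theorem exists_two_valued_functional {V : Set E} (hV : V.Finite)
    (hne : (interior (convexHull ℝ V)).Nonempty)
    (hcov : ∀ p ∈ convexHull ℝ V, ∃ v ∈ V, (2 : ℝ) • p - v ∈ convexHull ℝ V)
    (hanti : ∀ v ∈ V, ∀ w ∈ V, v ≠ w → IsAntipodalPair (convexHull ℝ V) v w)
    (hcard : V.ncard = 2 ^ finrank ℝ E) {u : E} (hu : u ≠ 0) :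
    ∃ f : Dual ℝ E, (∃ a : ℝ, ∀ v ∈ V, f v = a ∨ f v = a + 1) ∧ f u ≠ 0 := by
  obtain ⟨v, hv, w, hw, f, hlt, hfV, hfu, hspan₀, hspan₁⟩ := exists_facet_pair hV hne hcov hanti hu
  have hneg : {z ∈ V | (-f) z = (-f) v} = {z ∈ V | f z = f v} := by simp
  have h₀ := two_pow_finrank_le_of_facet hV hcov (f := -f) hv
    (fun z hz => by simpa using (hfV z hz).1) (hneg ▸ hspan₀)
  rw [hneg] at h₀
  have h₁ := two_pow_finrank_le_of_facet hV hcov hw (fun z hz => (hfV z hz).2) hspan₁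
  have hdisj : Disjoint {z ∈ V | f z = f v} {z ∈ V | f z = f w} := by
    rw [disjoint_left]
    rintro z ⟨-, h⟩ ⟨-, h'⟩
    exact hlt.ne (h.symm.trans h')
  have hunion : {z ∈ V | f z = f v} ∪ {z ∈ V | f z = f w} = V := by
    refine eq_of_subset_of_ncard_le (union_subset (sep_subset _ _) (sep_subset _ _)) ?_ hV
    rw [ncard_union_eq hdisj (hV.subset (sep_subset _ _)) (hV.subset (sep_subset _ _)), hcard]
    omega
  have hd : f w - f v ≠ 0 := sub_ne_zero.2 hlt.ne'
  refine ⟨(f w - f v)⁻¹ • f, ⟨(f w - f v)⁻¹ * f v, fun z hz => ?_⟩, by simp [hd, hfu]⟩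
  rw [← hunion] at hz
  rcases hz with ⟨-, h⟩ | ⟨-, h⟩
  · left; simp [h]
  · right
    simp only [LinearMap.smul_apply, smul_eq_mul, h]
    field_simp
    ring

theorem ncard_pi_pair (ι : Type*) [Fintype ι] :
    (univ.pi fun _ : ι => ({0, 1} : Set ℝ)).ncard = 2 ^ Fintype.card ι := by
  classical
  have h : (univ.pi fun _ : ι => ({0, 1} : Set ℝ)) =
      (Fintype.piFinset fun _ : ι => ({0, 1} : Finset ℝ) : Finset (ι → ℝ)) := by
    ext; simp [mem_pi]
  rw [h, ncard_coe_finset, Fintype.card_piFinset]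
  simp

/-- An antipodal set of `2 ^ d` points whose half-size copies cover is the vertex set of a
parallelotope. -/
theorem exists_affineEquiv_eq_image {d : ℕ} (hd : finrank ℝ E = d) {V : Set E} (hV : V.Finite)
    (hne : (interior (convexHull ℝ V)).Nonempty)
    (hcov : ∀ p ∈ convexHull ℝ V, ∃ v ∈ V, (2 : ℝ) • p - v ∈ convexHull ℝ V)
    (hanti : ∀ v ∈ V, ∀ w ∈ V, v ≠ w → IsAntipodalPair (convexHull ℝ V) v w)
    (hcard : V.ncard = 2 ^ finrank ℝ E) :
    ∃ φ : (Fin d → ℝ) ≃ᵃ[ℝ] E, V = φ '' univ.pi fun _ => {0, 1} := by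
  set W : Set (Dual ℝ E) := {f | ∃ a : ℝ, ∀ v ∈ V, f v = a ∨ f v = a + 1} with hW
  have hspan : Submodule.span ℝ W = ⊤ := by
    rw [← Subspace.dualCoannihilator_dualAnnihilator_eq (W := Submodule.span ℝ W)]
    have : (Submodule.span ℝ W).dualCoannihilator = ⊥ := by
      rw [eq_bot_iff]
      intro u hu
      by_contra hu0
      obtain ⟨f, hf, hfu⟩ := exists_two_valued_functional hV hne hcov hanti hcard hu0
      exact hfu ((Submodule.mem_dualCoannihilator u).1 hu f (Submodule.subset_span hf))
    rw [this, Submodule.dualAnnihilator_bot]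
  let b₀ := Basis.ofSpan hspan.ge
  let b : Basis (Fin d) ℝ (Dual ℝ E) :=
    b₀.reindex (b₀.indexEquiv (finBasisOfFinrankEq ℝ (Dual ℝ E) (Subspace.dual_finrank_eq.trans hd)))
  have hbW : ∀ i, b i ∈ W := fun i => by
    rw [Basis.reindex_apply]
    exact Basis.ofSpan_subset hspan.ge (mem_range_self _)
  choose a ha using hbW
  let L : E →ₗ[ℝ] (Fin d → ℝ) := LinearMap.pi b
  have hL : Function.Injective L := by
    rw [← LinearMap.ker_eq_bot, eq_bot_iff]
    intro x hx
    refine (forall_dual_apply_eq_zero_iff ℝ x).1 fun g => ?_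
    rw [← b.sum_repr g]
    have : ∀ i, b i x = 0 := fun i => congrFun (LinearMap.mem_ker.1 hx) i
    rw [LinearMap.sum_apply]
    exact Finset.sum_eq_zero fun i _ => by rw [LinearMap.smul_apply, this, smul_zero]
  let ψ : E ≃ᵃ[ℝ] (Fin d → ℝ) :=
    (L.linearEquivOfInjective hL (by simp [hd])).toAffineEquiv.trans
      (AffineEquiv.constVAdd ℝ (Fin d → ℝ) (-a))
  have hψ : ∀ x i, ψ x i = b i x - a i := fun x i => by
    simp [ψ, L, sub_eq_neg_add]
  -- The inclusion in the discrete cube is an equality because both sides have `2 ^ d` elements.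
  have himg : ψ '' V = univ.pi fun _ => {0, 1} := by
    refine eq_of_subset_of_ncard_le ?_ ?_ (Finite.pi fun _ => toFinite _)
    · rintro _ ⟨v, hv, rfl⟩ i -
      rcases ha i v hv with h | h <;> simp [hψ, h]
    · rw [ncard_pi_pair, ncard_image_of_injective _ ψ.injective, hcard, hd, Fintype.card_fin]
  refine ⟨ψ.symm, ?_⟩
  rw [← himg, ← image_comp]
  simp

end Cube

/-! ### Supporting hyperplanes versus functionals. -/

section Antipodality
variable {d : ℕ}

theorem AreAntipodal.isAntipodalPair {C : Set (EuclideanSpace ℝ (Fin d))}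
    {a b : EuclideanSpace ℝ (Fin d)} (ha : a ∈ C) (hb : b ∈ C) (h : AreAntipodal C a b) :
    IsAntipodalPair C a b := by
  obtain ⟨H₁, H₂, ⟨f, c, -, hH₁, -, hfC⟩, ⟨g, c', -, hH₂, -, hgC⟩, hne, ⟨v, hv⟩, haH, hbH⟩ := h
  have m₁ : ∀ y, y ∈ H₁ ↔ f y = c := fun y => by
    rw [← SetLike.mem_coe, hH₁]; rfl
  have m₂ : ∀ y, y ∈ H₂ ↔ g y = c' := fun y => by
    rw [← SetLike.mem_coe, hH₂]; rfl
  have m₂' : ∀ y, y ∈ H₂ ↔ f y = c + f v := fun y => by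
    rw [hv, AffineSubspace.mem_map]
    constructor
    · rintro ⟨z, hz, rfl⟩
      simp [(m₁ z).1 hz, add_comm]
    · intro hy
      exact ⟨y - v, (m₁ _).2 (by rw [map_sub, hy]; ring), by simp⟩
  have hv0 : f v ≠ 0 := by
    intro h0
    refine hne (AffineSubspace.ext fun y => ?_)
    rw [m₁, m₂', h0, add_zero]
  have hfa := (m₁ a).1 haH
  have hfb := (m₂' b).1 hbH
  have hlt : f b < f a := lt_of_le_of_ne (by rw [hfa]; exact hfC b hb) (by
    rw [hfa, hfb]; simpa using hv0)
  refine ⟨f, hlt, fun y hy => ⟨?_, by rw [hfa]; exact hfC y hy⟩⟩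
  -- If `y` lay beyond `H₂`, the segment from `y` to `a` would cross `H₂` at a proper convex
  -- combination; there `g` attains its bound `c'`, hence also at `a`, putting `a` on `H₂`.
  by_contra! hy'
  set D := f a - f y with hD
  have hD0 : 0 < D := by linarith
  have hg1 := hgC y hy
  have hg2 := hgC a ha
  have hz : g (((f a - f b) / D) • y + ((f b - f y) / D) • a) = c' := by
    rw [← m₂, m₂', ← hfb]
    simp only [map_add, map_smul, smul_eq_mul]
    field_simp
    rw [hD]; ring
  simp only [map_add, map_smul, smul_eq_mul] at hz
  have hs : (f a - f b) / D + (f b - f y) / D = 1 := by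
    field_simp
    rw [hD]; ring
  have hp1 : 0 < (f a - f b) / D := div_pos (by linarith) hD0
  have hp2 : 0 < (f b - f y) / D := div_pos (by linarith) hD0
  have hga : g a = c' := by
    refine le_antisymm hg2 ?_
    by_contra! hcon
    have hc' : (f a - f b) / D * c' + (f b - f y) / D * c' = c' := by rw [← add_mul, hs, one_mul]
    linarith [mul_le_mul_of_nonneg_left hg1 hp1.le, mul_lt_mul_of_pos_left hcon hp2]
  exact hlt.ne' ((m₂' a).1 ((m₂ a).2 hga) |>.trans hfb.symm)

theorem IsAntipodalPair.areAntipodal {C : Set (EuclideanSpace ℝ (Fin d))}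
    {a b : EuclideanSpace ℝ (Fin d)} (ha : a ∈ C) (hb : b ∈ C) (h : IsAntipodalPair C a b) :
    AreAntipodal C a b := by
  obtain ⟨f, hlt, hf⟩ := h
  have hf0 : f ≠ 0 := by rintro rfl; simp at hlt
  have hmem : ∀ p y, y ∈ AffineSubspace.mk' p (LinearMap.ker f) ↔ f y = f p := fun p y => by
    rw [AffineSubspace.mem_mk', LinearMap.mem_ker, vsub_eq_sub, map_sub, sub_eq_zero]
  refine ⟨AffineSubspace.mk' a (LinearMap.ker f), AffineSubspace.mk' b (LinearMap.ker f),
    ⟨f, f a, hf0, ?_, ⟨a, ha, (hmem a a).2 rfl⟩, fun y hy => (hf y hy).2⟩,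
    ⟨-f, -f b, neg_ne_zero.2 hf0, ?_, ⟨b, hb, (hmem b b).2 rfl⟩,
      fun y hy => by simpa using (hf y hy).1⟩, fun he => ?_, ⟨b - a, ?_⟩,
      (hmem a a).2 rfl, (hmem b b).2 rfl⟩
  · ext y; exact hmem a y
  · ext y
    refine (hmem b y).trans ?_
    simp
  · exact hlt.ne' ((hmem b a).1 (he ▸ (hmem a a).2 rfl))
  · ext y
    rw [hmem, AffineSubspace.mem_map]
    constructor
    · intro hy
      exact ⟨y - (b - a), (hmem a _).2 (by simp [hy]), by simp⟩
    · rintro ⟨z, hz, rfl⟩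
      have := (hmem a z).1 hz
      simp [this]

theorem isKAntipodal_iff {n k : ℕ} {x : Fin n → EuclideanSpace ℝ (Fin d)} :
    IsKAntipodal k x ↔ ∀ s : Finset (Fin n), s.card = k →
      ∃ i ∈ s, ∃ j ∈ s, IsAntipodalPair (convexHull ℝ (range x)) (x i) (x j) := by
  have hx : ∀ i, x i ∈ convexHull ℝ (range x) := fun i => subset_convexHull ℝ _ (mem_range_self i)
  refine forall₂_congr fun s _ => ⟨?_, ?_⟩
  · rintro ⟨i, hi, j, hj, -, h⟩
    exact ⟨i, hi, j, hj, h.isAntipodalPair (hx i) (hx j)⟩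
  · rintro ⟨i, hi, j, hj, h⟩
    rcases lt_trichotomy i j with hij | rfl | hij
    · exact ⟨i, hi, j, hj, hij, h.areAntipodal (hx i) (hx j)⟩
    · exact absurd rfl h.ne
    · exact ⟨j, hj, i, hi, hij, h.symm.areAntipodal (hx j) (hx i)⟩

end Antipodality

/-! ### The norm of a symmetric convex body. -/

section Norm
variable {d : ℕ} {K : Set (EuclideanSpace ℝ (Fin d))}

theorem mem_nhds_zero_of_mem_symmConvexBodies (hK : K ∈ symmConvexBodies d) : K ∈ nhds 0 := by
  obtain ⟨hc, -, ⟨p, hp⟩, hs⟩ := hK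
  rw [← mem_interior_iff_mem_nhds]
  have h := hc.combo_interior_self_mem_interior hp (hs _ (interior_subset hp)) (a := 1 / 2)
    (b := 1 / 2) (by norm_num) (by norm_num) (by norm_num)
  simpa using h

theorem bodyNorm_nonneg (x : EuclideanSpace ℝ (Fin d)) : 0 ≤ bodyNorm K x := gauge_nonneg x

theorem bodyNorm_smul {r : ℝ} (hr : 0 ≤ r) (x : EuclideanSpace ℝ (Fin d)) :
    bodyNorm K (r • x) = r * bodyNorm K x := gauge_smul_of_nonneg hr x

theorem bodyNorm_add_le (hK : K ∈ symmConvexBodies d) (x y : EuclideanSpace ℝ (Fin d)) :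
    bodyNorm K (x + y) ≤ bodyNorm K x + bodyNorm K y :=
  gauge_add_le hK.1 (absorbent_nhds_zero (mem_nhds_zero_of_mem_symmConvexBodies hK)) x y

theorem bodyNorm_neg (hK : K ∈ symmConvexBodies d) (x : EuclideanSpace ℝ (Fin d)) :
    bodyNorm K (-x) = bodyNorm K x := gauge_neg hK.2.2.2 x

theorem bodyNorm_sub_comm (hK : K ∈ symmConvexBodies d) (x y : EuclideanSpace ℝ (Fin d)) :
    bodyNorm K (x - y) = bodyNorm K (y - x) := by
  rw [← bodyNorm_neg hK, neg_sub]

theorem bodyNorm_pos (hK : K ∈ symmConvexBodies d) {x : EuclideanSpace ℝ (Fin d)} (hx : x ≠ 0) :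
    0 < bodyNorm K x :=
  (gauge_pos (absorbent_nhds_zero (mem_nhds_zero_of_mem_symmConvexBodies hK))
    (hK.2.1.isVonNBounded ℝ)).2 hx

theorem bodyNorm_le_iff (hK : K ∈ symmConvexBodies d) {x : EuclideanSpace ℝ (Fin d)} {r : ℝ}
    (hr : 0 < r) : bodyNorm K x ≤ r ↔ x ∈ r • K := by
  refine ⟨fun h => ?_, fun h => (isLeast_bodyNorm hK x).2 ⟨hr.le, h⟩⟩
  obtain ⟨z, hz, hzx⟩ := (isLeast_bodyNorm hK x).1.2
  have h0 : (0 : EuclideanSpace ℝ (Fin d)) ∈ K :=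
    mem_of_mem_nhds (mem_nhds_zero_of_mem_symmConvexBodies hK)
  refine ⟨(bodyNorm K x / r) • z, hK.1.smul_mem_of_zero_mem h0 hz
    ⟨div_nonneg (bodyNorm_nonneg x) hr.le, (div_le_one hr).2 h⟩, ?_⟩
  simp only at hzx ⊢
  rw [smul_smul, mul_div_cancel₀ _ hr.ne', hzx]

/-- Hahn–Banach: every point has a supporting functional. -/
theorem exists_supporting_functional (hK : K ∈ symmConvexBodies d)
    (x : EuclideanSpace ℝ (Fin d)) :
    ∃ g : EuclideanSpace ℝ (Fin d) →ₗ[ℝ] ℝ, g x = bodyNorm K x ∧ ∀ y, g y ≤ bodyNorm K y := by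
  rcases eq_or_ne x 0 with rfl | hx
  · exact ⟨0, by simp [bodyNorm], fun y => by simpa using bodyNorm_nonneg y⟩
  obtain ⟨g, hg, hgK⟩ := exists_extension_of_le_sublinear
    (LinearPMap.mkSpanSingleton x (bodyNorm K x) hx) (bodyNorm K)
    (fun c hc y => bodyNorm_smul hc.le y) (bodyNorm_add_le hK) (by
      rintro ⟨y, hy⟩
      obtain ⟨c, rfl⟩ := Submodule.mem_span_singleton.1 hy
      have : (LinearPMap.mkSpanSingleton x (bodyNorm K x) hx) ⟨c • x, hy⟩ = c • bodyNorm K x :=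
        LinearPMap.mkSpanSingleton'_apply ..
      rw [this, smul_eq_mul]
      rcases le_total 0 c with hc | hc
      · exact (bodyNorm_smul hc x).ge
      · exact (mul_nonpos_of_nonpos_of_nonneg hc (bodyNorm_nonneg x)).trans (bodyNorm_nonneg _))
  refine ⟨g, ?_, hgK⟩
  have := hg ⟨x, Submodule.mem_span_singleton_self x⟩
  rw [this]
  exact LinearPMap.mkSpanSingleton_apply ..

end Norm

/-! ### Equivalence of `k`-diametral and `k`-antipodal. -/

section Diametral
variable {d n k : ℕ} {K : Set (EuclideanSpace ℝ (Fin d))} {x : Fin n → EuclideanSpace ℝ (Fin d)}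

theorem finite_setOf_bodyNorm :
    {r : ℝ | ∃ i j : Fin n, i < j ∧ r = bodyNorm K (x i - x j)}.Finite := by
  refine (finite_range fun p : Fin n × Fin n => bodyNorm K (x p.1 - x p.2)).subset ?_
  rintro _ ⟨i, j, -, rfl⟩
  exact ⟨(i, j), rfl⟩

theorem bodyNorm_sub_le_configDiam (hK : K ∈ symmConvexBodies d) (h : 0 < configDiam K x)
    (i j : Fin n) : bodyNorm K (x i - x j) ≤ configDiam K x := by
  rcases lt_trichotomy i j with hij | rfl | hij
  · exact le_csSup finite_setOf_bodyNorm.bddAbove ⟨i, j, hij, rfl⟩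
  · simpa [bodyNorm] using h.le
  · rw [bodyNorm_sub_comm hK]
    exact le_csSup finite_setOf_bodyNorm.bddAbove ⟨j, i, hij, rfl⟩

theorem configDiam_eq (hK : K ∈ symmConvexBodies d) {δ : ℝ}
    (hle : ∀ i j, bodyNorm K (x i - x j) ≤ δ) {i j : Fin n} (hij : i ≠ j)
    (he : bodyNorm K (x i - x j) = δ) : configDiam K x = δ := by
  refine IsGreatest.csSup_eq ⟨?_, ?_⟩
  · rcases lt_or_gt_of_ne hij with h | h
    · exact ⟨i, j, h, he.symm⟩
    · exact ⟨j, i, h, by rw [← he, bodyNorm_sub_comm hK]⟩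
  · rintro _ ⟨a, b, -, rfl⟩
    exact hle a b

theorem isKDiametral_of_forall (hK : K ∈ symmConvexBodies d) {δ : ℝ} (hδ : 0 < δ)
    (hle : ∀ i j, bodyNorm K (x i - x j) ≤ δ) {i j : Fin n}
    (he : bodyNorm K (x i - x j) = δ)
    (h : ∀ s : Finset (Fin n), s.card = k → ∃ i ∈ s, ∃ j ∈ s, bodyNorm K (x i - x j) = δ) :
    IsKDiametral K k x := by
  have hne : ∀ {i j : Fin n}, bodyNorm K (x i - x j) = δ → i ≠ j := by
    rintro i _ hij rfl
    simp only [sub_self, bodyNorm, gauge_zero] at hij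
    exact hδ.ne hij
  have hd := configDiam_eq hK hle (hne he) he
  refine ⟨hd ▸ hδ, fun s hs => ?_⟩
  rw [hd]
  obtain ⟨i, hi, j, hj, hij⟩ := h s hs
  rcases lt_or_gt_of_ne (hne hij) with hlt | hlt
  · exact ⟨i, hi, j, hj, hlt, hij⟩
  · exact ⟨j, hj, i, hi, hlt, by rw [bodyNorm_sub_comm hK, hij]⟩

theorem IsKDiametral.isKAntipodal (hK : K ∈ symmConvexBodies d) (h : IsKDiametral K k x) :
    IsKAntipodal k x := by
  rw [isKAntipodal_iff]
  intro s hs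
  obtain ⟨i, hi, j, hj, -, hij⟩ := h.2 s hs
  refine ⟨i, hi, j, hj, isAntipodalPair_convexHull.2 ?_⟩
  obtain ⟨g, hg, hgK⟩ := exists_supporting_functional hK (x i - x j)
  rw [hij, map_sub] at hg
  refine ⟨g, by linarith [h.1], ?_⟩
  rintro _ ⟨l, rfl⟩
  -- The gap of `g` between `x i` and `x j` is the whole diameter, so no `x l` can fall outside the
  -- slab between them.
  have h1 := (hgK (x i - x l)).trans (bodyNorm_sub_le_configDiam hK h.1 i l)
  have h2 := (hgK (x l - x j)).trans (bodyNorm_sub_le_configDiam hK h.1 l j)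
  rw [map_sub] at h1 h2
  constructor <;> linarith

theorem closedBall_mem_symmConvexBodies {R : ℝ} (hR : 0 < R) :
    Metric.closedBall (0 : EuclideanSpace ℝ (Fin d)) R ∈ symmConvexBodies d :=
  ⟨convex_closedBall _ _, isCompact_closedBall _ _,
    ⟨0, Metric.ball_subset_interior_closedBall (Metric.mem_ball_self hR)⟩, by simp⟩

theorem IsKAntipodal.exists_isKDiametral (h : IsKAntipodal k x)
    (hx : k ≤ n ∨ ∃ i j, x i ≠ x j) : ∃ K ∈ symmConvexBodies d, IsKDiametral K k x := by
  rw [isKAntipodal_iff] at h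
  rcases le_or_gt k n with hkn | hkn
  · have hG : ∀ p : Fin n × Fin n, ∃ g : EuclideanSpace ℝ (Fin d) →ₗ[ℝ] ℝ,
        (∀ a b, |g (x a - x b)| ≤ 1) ∧
          (IsAntipodalPair (convexHull ℝ (range x)) (x p.1) (x p.2) → g (x p.1 - x p.2) = 1) := by
      intro p
      by_cases hp : IsAntipodalPair (convexHull ℝ (range x)) (x p.1) (x p.2)
      · obtain ⟨f, hf, hfx⟩ := isAntipodalPair_convexHull.1 hp
        have hpos : 0 < f (x p.1) - f (x p.2) := by linarith
        refine ⟨(f (x p.1) - f (x p.2))⁻¹ • f, fun a b => ?_, fun _ => ?_⟩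
        · have ha := hfx _ (mem_range_self a)
          have hb := hfx _ (mem_range_self b)
          rw [LinearMap.smul_apply, smul_eq_mul, abs_mul, abs_inv, abs_of_pos hpos,
            inv_mul_le_one₀ hpos, map_sub, abs_le]
          constructor <;> linarith
        · rw [LinearMap.smul_apply, smul_eq_mul, map_sub, inv_mul_cancel₀ hpos.ne']
      · exact ⟨0, by simp, fun h => absurd h hp⟩
    choose G hG1 hG2 using hG
    -- The slabs alone may have an unbounded intersection. The ball restores compactness and is
    -- large enough to contain all differences `x a - x b`.
    set R : ℝ := 1 + ∑ p : Fin n × Fin n, ‖x p.1 - x p.2‖ with hR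
    have hR0 : 0 < R := by positivity
    let K : Set (EuclideanSpace ℝ (Fin d)) :=
      Metric.closedBall 0 R ∩ ⋂ p, G p ⁻¹' Icc (-1) 1
    have hcont : ∀ p, Continuous (G p) := fun p => (G p).continuous_of_finiteDimensional
    have hK : K ∈ symmConvexBodies d := by
      refine ⟨(convex_closedBall _ _).inter
          (convex_iInter fun p => (convex_Icc _ _).linear_preimage (G p)),
        (isCompact_closedBall _ _).inter_right
          (isClosed_iInter fun p => isClosed_Icc.preimage (hcont p)), ⟨0, ?_⟩, ?_⟩
      · rw [mem_interior_iff_mem_nhds]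
        refine Filter.inter_mem (Metric.closedBall_mem_nhds _ hR0) (Filter.iInter_mem.2 fun p => ?_)
        refine (hcont p).continuousAt.preimage_mem_nhds ?_
        rw [map_zero]
        exact Icc_mem_nhds (by norm_num) (by norm_num)
      · rintro z ⟨hz, hzG⟩
        refine ⟨by simpa using hz, mem_iInter.2 fun p => ?_⟩
        have := mem_iInter.1 hzG p
        simp only [mem_preimage, map_neg, mem_Icc] at this ⊢
        constructor <;> linarith
    have hmem : ∀ a b, x a - x b ∈ K := fun a b => by
      refine ⟨?_, mem_iInter.2 fun p => abs_le.1 (hG1 p a b)⟩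
      rw [mem_closedBall_zero_iff]
      have := Finset.single_le_sum (f := fun p : Fin n × Fin n => ‖x p.1 - x p.2‖)
        (fun p _ => norm_nonneg _) (Finset.mem_univ (a, b))
      simp only at this
      linarith
    have hle : ∀ a b, bodyNorm K (x a - x b) ≤ 1 := fun a b => gauge_le_one_of_mem (hmem a b)
    have heq : ∀ a b, IsAntipodalPair (convexHull ℝ (range x)) (x a) (x b) →
        bodyNorm K (x a - x b) = 1 := fun a b hab => by
      refine le_antisymm (hle a b) ?_
      obtain ⟨hr, z, hz, hzx⟩ := (isLeast_bodyNorm hK (x a - x b)).1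
      have h1 := hG2 (a, b) hab
      simp only at h1 hzx
      rw [← hzx, map_smul, smul_eq_mul] at h1
      have h2 := (mem_iInter.1 hz.2 (a, b)).2
      nlinarith
    obtain ⟨s, -, hs⟩ := Finset.exists_subset_card_eq (s := (Finset.univ : Finset (Fin n)))
      (n := k) (by simpa using hkn)
    obtain ⟨i, -, j, -, hij⟩ := h s hs
    refine ⟨K, hK, isKDiametral_of_forall hK one_pos hle (heq i j hij) fun t ht => ?_⟩
    obtain ⟨a, ha, b, hb, hab⟩ := h t ht
    exact ⟨a, ha, b, hb, heq a b hab⟩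
  -- For `n < k` there are no `k`-subsets, so only a positive diameter is needed and any norm
  -- serves.
  · obtain ⟨i, j, hij⟩ := hx.resolve_left hkn.not_ge
    have hK := closedBall_mem_symmConvexBodies (d := d) one_pos
    refine ⟨_, hK, ?_, fun s hs => ?_⟩
    · have hlt : ∀ a b : Fin n, a < b → x a ≠ x b →
          0 < configDiam (Metric.closedBall (0 : EuclideanSpace ℝ (Fin d)) 1) x := fun a b hab hne =>
        (bodyNorm_pos hK (sub_ne_zero.2 hne)).trans_le
          (le_csSup finite_setOf_bodyNorm.bddAbove ⟨a, b, hab, rfl⟩)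
      rcases lt_trichotomy i j with hlt' | rfl | hlt'
      · exact hlt i j hlt' hij
      · exact absurd rfl hij
      · exact hlt j i hlt' hij.symm
    · have := s.card_le_univ
      rw [Fintype.card_fin] at this
      omega

end Diametral

/-! ### Cubes, their vertices and their norms. -/

section CubeConfig
variable {d : ℕ}

theorem image_extremePoints_subset_of_affineEquiv {E F : Type*} [AddCommGroup E] [Module ℝ E]
    [AddCommGroup F] [Module ℝ F] (φ : E ≃ᵃ[ℝ] F) (S : Set E) :
    φ '' extremePoints ℝ S ⊆ extremePoints ℝ (φ '' S) := by
  rintro _ ⟨v, hv, rfl⟩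
  refine ⟨mem_image_of_mem φ hv.1, ?_⟩
  rintro _ ⟨a, ha, rfl⟩ _ ⟨b, hb, rfl⟩ hab
  have h := image_openSegment ℝ (φ : E →ᵃ[ℝ] F) a b
  rw [AffineEquiv.coe_toAffineMap] at h
  rw [← h] at hab
  rw [hv.2 ha hb (φ.injective.mem_set_image.1 hab)]

theorem image_extremePoints_of_affineEquiv {E F : Type*} [AddCommGroup E] [Module ℝ E]
    [AddCommGroup F] [Module ℝ F] (φ : E ≃ᵃ[ℝ] F) (S : Set E) :
    φ '' extremePoints ℝ S = extremePoints ℝ (φ '' S) := by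
  refine (image_extremePoints_subset_of_affineEquiv φ S).antisymm fun y hy => ?_
  have h := image_extremePoints_subset_of_affineEquiv φ.symm (φ '' S) ⟨y, hy, rfl⟩
  rw [← image_comp] at h
  have hid : (φ.symm ∘ φ : E → E) = id := by ext; simp
  rw [hid, image_id] at h
  exact ⟨_, h, by simp⟩

theorem extremePoints_Icc_zero_one (ι : Type*) :
    extremePoints ℝ (Icc (0 : ι → ℝ) 1) = univ.pi fun _ => {0, 1} := by
  rw [← pi_univ_Icc, extremePoints_pi]
  simp [Set.extremePoints_Icc]

theorem extremePoints_image_Icc {d : ℕ} (φ : (Fin d → ℝ) ≃ᵃ[ℝ] EuclideanSpace ℝ (Fin d)) :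
    extremePoints ℝ (φ '' Icc 0 1) = φ '' univ.pi fun _ => {0, 1} := by
  rw [← image_extremePoints_of_affineEquiv, extremePoints_Icc_zero_one]

theorem IsAffineCube.ncard_extremePoints {C : Set (EuclideanSpace ℝ (Fin d))}
    (hC : IsAffineCube C) : (extremePoints ℝ C).ncard = 2 ^ d := by
  obtain ⟨φ, rfl⟩ := hC
  rw [extremePoints_image_Icc, ncard_image_of_injective _ φ.injective, ncard_pi_pair,
    Fintype.card_fin]

theorem exists_isVertexConfig {C : Set (EuclideanSpace ℝ (Fin d))} (hC : IsAffineCube C) (m : ℕ) :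
    ∃ x : Fin (m * 2 ^ d) → EuclideanSpace ℝ (Fin d), IsVertexConfig C m x := by
  have hcard := hC.ncard_extremePoints
  have hfin : (extremePoints ℝ C).Finite := finite_of_ncard_pos (by rw [hcard]; positivity)
  have := hfin.fintype
  have hc : Fintype.card (Fin m × extremePoints ℝ C) = m * 2 ^ d := by
    rw [Fintype.card_prod, Fintype.card_fin, ← hcard, ← Nat.card_coe_set_eq,
      Nat.card_eq_fintype_card]
  let e := (Fintype.equivFinOfCardEq hc).symm
  refine ⟨fun i => (e i).2, fun i => (e i).2.2, fun v hv => ?_⟩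
  have himg : {i | ((e i).2 : EuclideanSpace ℝ (Fin d)) = v} =
      range fun a : Fin m => e.symm (a, ⟨v, hv⟩) := by
    ext i
    constructor
    · intro hi
      refine ⟨(e i).1, ?_⟩
      rw [Equiv.symm_apply_eq]
      exact Prod.ext rfl (Subtype.ext hi.symm)
    · rintro ⟨a, rfl⟩
      simp
  rw [himg, ← image_univ, ncard_image_of_injective, ncard_univ, Nat.card_eq_fintype_card,
    Fintype.card_fin]
  intro a b hab
  simpa using hab

/-- The distance of two vertices of a cube in its own norm. -/
theorem bodyNorm_sub_of_mem_extremePoints {K C : Set (EuclideanSpace ℝ (Fin d))}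
    (hK : K ∈ symmConvexBodies d) (hC : IsAffineCube C) {y : EuclideanSpace ℝ (Fin d)} {r : ℝ}
    (hr : 0 < r) (hCK : C = y +ᵥ r • K) {v w : EuclideanSpace ℝ (Fin d)}
    (hv : v ∈ extremePoints ℝ C) (hw : w ∈ extremePoints ℝ C) (hne : v ≠ w) :
    bodyNorm K (v - w) = 2 * r := by
  have hmem : ∀ z ∈ C, ∃ a ∈ K, z = y + r • a := by
    intro z hz
    rw [hCK] at hz
    obtain ⟨_, ⟨a, ha, rfl⟩, rfl⟩ := hz
    exact ⟨a, ha, rfl⟩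
  have hmem' : ∀ a ∈ K, y + r • a ∈ C := by
    intro a ha
    rw [hCK]
    exact ⟨_, ⟨a, ha, rfl⟩, rfl⟩
  refine le_antisymm ?_ ?_
  · obtain ⟨a, ha, rfl⟩ := hmem v hv.1
    obtain ⟨b, hb, rfl⟩ := hmem w hw.1
    have he : y + r • a - (y + r • b) = r • (a + -b) := by module
    rw [he, bodyNorm_smul hr.le]
    have h1 := bodyNorm_add_le hK a (-b)
    have h2 : bodyNorm K a ≤ 1 := gauge_le_one_of_mem ha
    have h3 : bodyNorm K (-b) ≤ 1 := gauge_le_one_of_mem (hK.2.2.2 b hb)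
    nlinarith
  · wlog hlt : ∃ φ : (Fin d → ℝ) ≃ᵃ[ℝ] EuclideanSpace ℝ (Fin d), C = φ '' Icc 0 1 ∧
        ∃ l, φ.symm v l - φ.symm w l = 1 generalizing v w with H
    · rw [bodyNorm_sub_comm hK]
      refine H hw hv hne.symm ?_
      obtain ⟨φ, hφ⟩ := hC
      refine ⟨φ, hφ, ?_⟩
      rw [hφ, extremePoints_image_Icc] at hv hw
      obtain ⟨s, hs, rfl⟩ := hv
      obtain ⟨t, ht, rfl⟩ := hw
      obtain ⟨l, hl⟩ : ∃ l, s l ≠ t l := by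
        by_contra! hc
        exact hne (congrArg φ (funext hc))
      refine ⟨l, ?_⟩
      have hn : ¬ (s l - t l = 1) := fun h => hlt ⟨φ, hφ, l, by simpa using h⟩
      have hsl := hs l trivial
      have htl := ht l trivial
      simp only [mem_insert_iff, mem_singleton_iff] at hsl htl
      simp only [AffineEquiv.symm_apply_apply]
      rcases hsl with h1 | h1 <;> rcases htl with h2 | h2 <;> simp_all
    obtain ⟨φ, hφ, l, hl⟩ := hlt
    have hsub : ∀ p q, φ.symm p l - φ.symm q l = φ.symm.linear (p - q) l := fun p q => by
      have := φ.symm.toAffineMap.linearMap_vsub p q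
      exact (congrFun this l).symm
    have hC01 : ∀ z ∈ C, 0 ≤ φ.symm z l ∧ φ.symm z l ≤ 1 := by
      intro z hz
      rw [hφ] at hz
      obtain ⟨t, ht, rfl⟩ := hz
      simpa using ⟨ht.1 l, ht.2 l⟩
    obtain ⟨hρ, a, ha, hav⟩ := (isLeast_bodyNorm hK (v - w)).1
    simp only at hav
    -- Write `v - w = ρ • a` with `ρ` its norm. Both `y ± r • a` lie in the cube, so the `l`-th
    -- coordinate of `a` is at most `1 / (2r)`, while `ρ` times it is 1.
    have h1 := hC01 _ (hmem' a ha)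
    have h2 := hC01 _ (hmem' (-a) (hK.2.2.2 a ha))
    have h3 := hsub (y + r • a) (y + r • -a)
    have he : y + r • a - (y + r • -a) = (2 * r) • a := by module
    rw [he, map_smul, Pi.smul_apply, smul_eq_mul] at h3
    rw [hsub, ← hav, map_smul, Pi.smul_apply, smul_eq_mul] at hl
    nlinarith

theorem IsVertexConfig.isKDiametral {n k : ℕ} (hd : 2 ≤ d) (hk : 2 ≤ k)
    {K C : Set (EuclideanSpace ℝ (Fin d))} {x : Fin n → EuclideanSpace ℝ (Fin d)}
    (hK : K ∈ symmConvexBodies d) (hC : IsAffineCube C) (hCK : IsHomothetic C K)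
    (hx : IsVertexConfig C (k - 1) x) : IsKDiametral K k x := by
  classical
  obtain ⟨y, r, hr, hCK⟩ := hCK
  have heq : ∀ {i j}, x i ≠ x j → bodyNorm K (x i - x j) = 2 * r := fun {i j} hij =>
    bodyNorm_sub_of_mem_extremePoints hK hC hr hCK (hx.1 i) (hx.1 j) hij
  have hex : ∀ v ∈ extremePoints ℝ C, ∃ i, x i = v := fun v hv =>
    nonempty_of_ncard_ne_zero (s := {i | x i = v}) (by rw [hx.2 v hv]; omega)
  obtain ⟨v, hv, w, hw, hvw⟩ := (one_lt_ncard (finite_of_ncard_pos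
    (by rw [hC.ncard_extremePoints]; positivity))).1 (by
      rw [hC.ncard_extremePoints]; exact Nat.one_lt_two_pow (by omega) : 1 < (extremePoints ℝ C).ncard)
  obtain ⟨i, rfl⟩ := hex v hv
  obtain ⟨j, rfl⟩ := hex w hw
  refine isKDiametral_of_forall hK (by positivity : 0 < 2 * r) (fun a b => ?_) (heq hvw)
    fun s hs => ?_
  · rcases eq_or_ne (x a) (x b) with h | h
    · simp only [h, sub_self, bodyNorm, gauge_zero]
      positivity
    · exact (heq h).le
  · by_contra! hcon
    have hall : ∀ a ∈ s, ∀ b ∈ s, x a = x b := fun a ha b hb => by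
      by_contra h
      exact hcon a ha b hb (heq h)
    obtain ⟨a, ha⟩ := Finset.card_pos.1 (by omega : 0 < s.card)
    have h1 : (s : Set (Fin n)).ncard ≤ {i | x i = x a}.ncard :=
      ncard_le_ncard (fun b hb => hall b hb a ha) (toFinite _)
    rw [ncard_coe_finset, hx.2 _ (hx.1 a)] at h1
    omega

theorem IsHomothetic.refl (K : Set (EuclideanSpace ℝ (Fin d))) : IsHomothetic K K :=
  ⟨0, 1, one_pos, by simp⟩

theorem IsAffineCube.of_isHomothetic {K C : Set (EuclideanSpace ℝ (Fin d))} (hC : IsAffineCube C)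
    (h : IsHomothetic C K) : IsAffineCube K := by
  obtain ⟨φ, hφ⟩ := hC
  obtain ⟨y, r, hr, hCK⟩ := h
  refine ⟨(φ.trans (AffineEquiv.constVAdd ℝ _ (-y))).trans
    (LinearEquiv.smulOfNeZero ℝ (EuclideanSpace ℝ (Fin d)) r⁻¹ (inv_ne_zero hr.ne')).toAffineEquiv, ?_⟩
  ext z
  constructor
  · intro hz
    have : y + r • z ∈ C := by rw [hCK]; exact ⟨_, ⟨z, hz, rfl⟩, rfl⟩
    rw [hφ] at this
    obtain ⟨t, ht, hty⟩ := this
    refine ⟨t, ht, ?_⟩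
    simp [hty, smul_smul, mul_inv_cancel₀ hr.ne']
  · rintro ⟨t, ht, rfl⟩
    have : φ t ∈ C := by rw [hφ]; exact ⟨t, ht, rfl⟩
    rw [hCK] at this
    obtain ⟨_, ⟨a, ha, rfl⟩, hay⟩ := this
    simp only [vadd_eq_add] at hay
    simpa [← hay, smul_smul, mul_inv_cancel₀ hr.ne'] using ha

theorem exists_isAffineCube_mem_symmConvexBodies (d : ℕ) :
    ∃ K ∈ symmConvexBodies d, IsAffineCube K := by
  let φ : (Fin d → ℝ) ≃ᵃ[ℝ] EuclideanSpace ℝ (Fin d) :=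
    (AffineEquiv.constVAdd ℝ (Fin d → ℝ) (fun _ => -(1 / 2))).trans
      (EuclideanSpace.equiv (Fin d) ℝ).symm.toLinearEquiv.toAffineEquiv
  have hφ : ∀ t i, φ t i = t i - 1 / 2 := fun t i => by
    simp [φ, sub_eq_neg_add]
  have hcont : Continuous φ := φ.toAffineMap.continuous_of_finiteDimensional
  refine ⟨φ '' Icc 0 1, ⟨(convex_Icc _ _).affine_image φ.toAffineMap, isCompact_Icc.image hcont,
    ?_, ?_⟩, φ, rfl⟩
  · have h1 : (interior (Icc (0 : Fin d → ℝ) 1)).Nonempty := by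
      rw [← pi_univ_Icc, interior_pi_set finite_univ]
      exact ⟨fun _ => 1 / 2, fun i _ => by
        simp only [Pi.zero_apply, Pi.one_apply, interior_Icc]; norm_num⟩
    refine (h1.image φ).mono (interior_maximal (image_mono interior_subset) ?_)
    have h2 := φ.toEquiv.image_eq_preimage_symm (interior (Icc 0 1))
    rw [show φ '' interior (Icc 0 1) = φ.symm ⁻¹' interior (Icc 0 1) from h2]
    exact isOpen_interior.preimage φ.symm.toAffineMap.continuous_of_finiteDimensional
  · rintro _ ⟨t, ht, rfl⟩
    refine ⟨1 - t, ⟨fun i => ?_, fun i => ?_⟩, ?_⟩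
    · have := ht.2 i
      simp only [Pi.zero_apply, Pi.one_apply, Pi.sub_apply] at this ⊢
      linarith
    · have := ht.1 i
      simp only [Pi.zero_apply, Pi.one_apply, Pi.sub_apply] at this ⊢
      linarith
    · ext i
      rw [PiLp.neg_apply, hφ, hφ, Pi.sub_apply, Pi.one_apply]
      ring

end CubeConfig

/-! ### Extremal configurations and the maxima. -/

section Extremal
variable {d n k : ℕ} {x : Fin n → EuclideanSpace ℝ (Fin d)}

theorem IsKAntipodal.card_le (hn : 1 ≤ n) (h : IsKAntipodal k x) : n ≤ (k - 1) * 2 ^ d := by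
  have : Nonempty (Fin n) := ⟨⟨0, hn⟩⟩
  simpa using card_le_mul_two_pow_finrank (isKAntipodal_iff.1 h)

theorem IsKAntipodal.exists_affineEquiv (hn : 1 ≤ n) (hk : 2 ≤ k) (h : IsKAntipodal k x)
    (hcard : n = (k - 1) * 2 ^ d) :
    ∃ φ : (Fin d → ℝ) ≃ᵃ[ℝ] EuclideanSpace ℝ (Fin d),
      range x = φ '' univ.pi (fun _ => {0, 1}) ∧ ∀ v ∈ range x, {i | x i = v}.ncard = k - 1 := by
  classical
  have : Nonempty (Fin n) := ⟨⟨0, hn⟩⟩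
  have h' := isKAntipodal_iff.1 h
  have hcard' : Fintype.card (Fin n) = (k - 1) * 2 ^ finrank ℝ (EuclideanSpace ℝ (Fin d)) := by
    simpa using hcard
  have hne := nonempty_interior_of_card_eq hk h' hcard'
  obtain ⟨hmult, hV⟩ := card_filter_eq_and_ncard_range hk hne h' hcard'
  obtain ⟨φ, hφ⟩ := exists_affineEquiv_eq_image (d := d) (by simp) (finite_range x) hne
    (fun p hp => exists_two_smul_sub_mem hk hne h' hcard' hp)
    (by
      rintro _ ⟨i, rfl⟩ w hw hne'
      exact isAntipodalPair_of_card_filter_eq hk h' (hmult w hw) hne') hV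
  refine ⟨φ, hφ, fun v hv => ?_⟩
  rw [← hmult v hv, ← ncard_coe_finset]
  simp

/-- A body for which all distances of distinct vertices of a cube are equal is homothetic to
that cube. -/
theorem eq_vadd_smul_of_forall_bodyNorm_eq {K : Set (EuclideanSpace ℝ (Fin d))} (hd : 1 ≤ d)
    (hK : K ∈ symmConvexBodies d) (φ : (Fin d → ℝ) ≃ᵃ[ℝ] EuclideanSpace ℝ (Fin d)) {δ : ℝ}
    (hδ : 0 < δ) (h : ∀ s ∈ univ.pi (fun _ : Fin d => ({0, 1} : Set ℝ)),
      ∀ t ∈ univ.pi (fun _ : Fin d => ({0, 1} : Set ℝ)), s ≠ t → bodyNorm K (φ s - φ t) = δ) :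
    φ '' Icc 0 1 = φ (fun _ => 1 / 2) +ᵥ (δ / 2) • K := by
  set L := φ.linear with hL
  have hsub : ∀ s t, φ s - φ t = L (s - t) := fun s t =>
    (φ.toAffineMap.linearMap_vsub s t).symm
  have hcoord : ∀ t : Fin d → ℝ, ∀ l, δ * |t l| ≤ bodyNorm K (L t) := by
    intro t l
    have hmem0 : (0 : Fin d → ℝ) ∈ univ.pi (fun _ : Fin d => ({0, 1} : Set ℝ)) := fun i _ => by simp
    have hmem1 : ∀ j, (Pi.single j 1 : Fin d → ℝ) ∈
        univ.pi (fun _ : Fin d => ({0, 1} : Set ℝ)) := fun j i _ => by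
      rcases eq_or_ne i j with rfl | hij
      · simp
      · simp [hij]
    have hmem2 : ∀ j, j ≠ l → (Pi.single l 1 + Pi.single j 1 : Fin d → ℝ) ∈
        univ.pi (fun _ : Fin d => ({0, 1} : Set ℝ)) := fun j hj i _ => by
      rcases eq_or_ne i j with rfl | hij
      · simp [hj]
      · rcases eq_or_ne i l with rfl | hil
        · simp [hij]
        · simp [hij, hil]
    obtain ⟨g, hg, hgK⟩ := exists_supporting_functional hK (L (Pi.single l 1))
    have hl : bodyNorm K (L (Pi.single l 1)) = δ := by
      rw [← h _ (hmem1 l) _ hmem0 (by simp), hsub, sub_zero]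
    rw [hl] at hg
    -- Both `e_l + e_j` and `e_l - e_j` are differences of cube vertices, so their images have norm
    -- `δ`. Since `g (L e_l) = δ` already, `g (L e_j)` is neither positive nor negative; thus `g ∘
    -- L` is `δ` times a coordinate.
    have hj : ∀ j, j ≠ l → g (L (Pi.single j 1)) = 0 := by
      intro j hj
      have h1 := hgK (L (Pi.single l 1 + Pi.single j 1))
      have h2 := hgK (L (Pi.single l 1 - Pi.single j 1))
      have hne : (Pi.single l 1 + Pi.single j 1 : Fin d → ℝ) ≠ 0 := fun he => by
        have := congrFun he l
        simp [hj.symm] at this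
      have hne' : (Pi.single l 1 : Fin d → ℝ) ≠ Pi.single j 1 := fun he => by
        have := congrFun he l
        simp [hj.symm] at this
      rw [← sub_zero (Pi.single l 1 + Pi.single j 1 : Fin d → ℝ), ← hsub,
        h _ (hmem2 j hj) _ hmem0 hne, hsub, sub_zero, map_add, map_add, hg] at h1
      rw [← hsub, h _ (hmem1 l) _ (hmem1 j) hne', hsub, map_sub, map_sub, hg] at h2
      linarith
    have hgt : g (L t) = t l * δ := by
      have ht : t = ∑ j, t j • (Pi.single j 1 : Fin d → ℝ) := pi_eq_sum_univ' t
      conv_lhs => rw [ht]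
      rw [map_sum, map_sum, Finset.sum_eq_single l]
      · rw [map_smul, map_smul, hg, smul_eq_mul]
      · intro j _ hjl
        rw [map_smul, map_smul, hj j hjl, smul_zero]
      · simp
    have h1 := hgK (L t)
    have h2 := hgK (-L t)
    rw [bodyNorm_neg hK, map_neg] at h2
    rw [hgt] at h1 h2
    rcases abs_cases (t l) with ⟨ha, -⟩ | ⟨ha, -⟩ <;> rw [ha] <;> linarith
  -- The centre is the midpoint of the opposite vertices `s` and `1 - s`, which are distinct because
  -- `d ≥ 1`.
  have hvert : ∀ s ∈ univ.pi (fun _ : Fin d => ({0, 1} : Set ℝ)),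
      bodyNorm K (φ s - φ (fun _ => 1 / 2)) ≤ δ / 2 := by
    intro s hs
    have hs' : (1 - s) ∈ univ.pi (fun _ : Fin d => ({0, 1} : Set ℝ)) := fun i _ => by
      rcases hs i trivial with hi | hi <;> simp_all
    have hne : s ≠ 1 - s := fun he => by
      have := congrFun he ⟨0, hd⟩
      rw [Pi.sub_apply, Pi.one_apply] at this
      rcases hs ⟨0, hd⟩ trivial with hi | hi <;> rw [hi] at this <;> norm_num at this
    have he : φ s - φ (fun _ => 1 / 2) = (1 / 2 : ℝ) • (φ s - φ (1 - s)) := by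
      rw [hsub, hsub, ← map_smul]
      congr 1
      ext i
      simp
      ring
    rw [he, bodyNorm_smul (by norm_num), h s hs _ hs' hne]
    linarith
  have hball : ∀ p, p ∈ φ (fun _ => 1 / 2) +ᵥ (δ / 2) • K ↔
      bodyNorm K (p - φ (fun _ => 1 / 2)) ≤ δ / 2 := fun p => by
    rw [bodyNorm_le_iff hK (by positivity), mem_vadd_set_iff_neg_vadd_mem, vadd_eq_add,
      sub_eq_neg_add]
  ext p
  rw [hball]
  constructor
  · rintro ⟨t, ht, rfl⟩
    have hconv : Convex ℝ (φ (fun _ => 1 / 2) +ᵥ (δ / 2) • K) := (hK.1.smul _).vadd _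
    have hsubset : convexHull ℝ (univ.pi fun _ : Fin d => ({0, 1} : Set ℝ)) ⊆
        φ.toAffineMap ⁻¹' (φ (fun _ => 1 / 2) +ᵥ (δ / 2) • K) :=
      convexHull_min (fun s hs => (hball _).2 (hvert s hs)) (hconv.affine_preimage _)
    rw [convexHull_pi] at hsubset
    refine (hball _).1 (hsubset fun i _ => ?_)
    rw [convexHull_pair, segment_eq_Icc zero_le_one]
    exact ⟨ht.1 i, ht.2 i⟩
  · intro hp
    obtain ⟨t, rfl⟩ := φ.surjective p
    rw [hsub] at hp
    have hl : ∀ l, |t l - 1 / 2| ≤ 1 / 2 := fun l => by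
      have := (hcoord _ l).trans hp
      rw [Pi.sub_apply] at this
      nlinarith
    refine ⟨t, ⟨fun l => ?_, fun l => ?_⟩, rfl⟩
    · have := (abs_le.1 (hl l)).1
      rw [Pi.zero_apply]; linarith
    · have := (abs_le.1 (hl l)).2
      rw [Pi.one_apply]; linarith

theorem IsKDiametral.exists_isVertexConfig (hd : 1 ≤ d) (hn : 1 ≤ n) (hk : 2 ≤ k)
    {K : Set (EuclideanSpace ℝ (Fin d))} (hK : K ∈ symmConvexBodies d) (h : IsKDiametral K k x)
    (hcard : n = (k - 1) * 2 ^ d) :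
    ∃ C, IsAffineCube C ∧ IsHomothetic C K ∧ IsVertexConfig C (k - 1) x := by
  classical
  obtain ⟨φ, hφ, hmult⟩ := (h.isKAntipodal hK).exists_affineEquiv hn hk hcard
  have hex : extremePoints ℝ (φ '' Icc 0 1) = range x := by
    rw [extremePoints_image_Icc, hφ]
  have hdist : ∀ i, ∀ v ∈ range x, x i ≠ v → bodyNorm K (x i - v) = configDiam K x := by
    intro i v hv hne
    refine rel_of_card_filter_eq (x := x) (R := fun a b => bodyNorm K (a - b) = configDiam K x) hk
      (fun hab => by rw [bodyNorm_sub_comm hK, hab]) ?_ ?_ ?_ hne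
    · rintro a _ hab rfl
      simp only [sub_self, bodyNorm, gauge_zero] at hab
      exact h.1.ne hab
    · intro s hs
      obtain ⟨a, ha, b, hb, -, hab⟩ := h.2 s hs
      exact ⟨a, ha, b, hb, hab⟩
    · rw [← hmult v hv, ← ncard_coe_finset]
      simp
  refine ⟨φ '' Icc 0 1, ⟨φ, rfl⟩, ⟨φ (fun _ => 1 / 2), configDiam K x / 2, by linarith [h.1],
    eq_vadd_smul_of_forall_bodyNorm_eq hd hK φ h.1 fun s hs t ht hst => ?_⟩, fun i => ?_, ?_⟩
  · have hs' : φ s ∈ range x := by rw [hφ]; exact ⟨s, hs, rfl⟩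
    have ht' : φ t ∈ range x := by rw [hφ]; exact ⟨t, ht, rfl⟩
    obtain ⟨i, hi⟩ := hs'
    rw [← hi]
    exact hdist i _ ht' (by rw [hi]; exact φ.injective.ne hst)
  · rw [hex]; exact mem_range_self i
  · rw [hex]; exact hmult

/-- Needed so that the supremum of the sizes is over a nonempty set, hence attained. For `k > 2` the
condition on `k`-subsets is vacuous. -/
theorem two_mem_diametralSizes (hd : 1 ≤ d) (hk : 2 ≤ k) {K : Set (EuclideanSpace ℝ (Fin d))}
    (hK : K ∈ symmConvexBodies d) : 2 ∈ diametralSizes K k := by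
  let e : EuclideanSpace ℝ (Fin d) := EuclideanSpace.single ⟨0, hd⟩ 1
  have he : e ≠ 0 := by simp [e]
  have hpos := bodyNorm_pos hK he
  have h01 : bodyNorm K (![0, e] 0 - ![0, e] 1) = bodyNorm K e := by simp [bodyNorm_neg hK]
  refine ⟨by norm_num, ![0, e], isKDiametral_of_forall hK hpos (fun i j => ?_) (i := 0) (j := 1)
    h01 fun s hs => ?_⟩
  · have h0 : bodyNorm K (0 : EuclideanSpace ℝ (Fin d)) = 0 := gauge_zero
    fin_cases i <;> fin_cases j <;> simp [bodyNorm_neg hK, h0, hpos.le]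
  · have hs' : s = Finset.univ := by
      refine Finset.eq_univ_of_card s (le_antisymm (Finset.card_le_univ s) ?_)
      simpa [hs] using hk
    exact ⟨0, by simp [hs'], 1, by simp [hs'], h01⟩

theorem le_of_mem_antipodalSizes {m : ℕ} (h : m ∈ antipodalSizes d k) : m ≤ (k - 1) * 2 ^ d := by
  obtain ⟨hm, x, hx⟩ := h
  exact hx.card_le hm

theorem diametralSizes_subset_antipodalSizes {K : Set (EuclideanSpace ℝ (Fin d))}
    (hK : K ∈ symmConvexBodies d) : diametralSizes K k ⊆ antipodalSizes d k :=
  fun _ ⟨hm, x, hx⟩ => ⟨hm, x, hx.isKAntipodal hK⟩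

theorem isGreatest_diametralNumber (hd : 1 ≤ d) (hk : 2 ≤ k)
    {K : Set (EuclideanSpace ℝ (Fin d))} (hK : K ∈ symmConvexBodies d) :
    IsGreatest (diametralSizes K k) (diametralNumber K k) := by
  have hb : BddAbove (diametralSizes K k) := ⟨(k - 1) * 2 ^ d, fun _ hm =>
    le_of_mem_antipodalSizes (diametralSizes_subset_antipodalSizes hK hm)⟩
  exact ⟨Nat.sSup_mem ⟨2, two_mem_diametralSizes hd hk hK⟩ hb, fun _ hm => le_csSup hb hm⟩

theorem mem_diametralSizes_of_isAffineCube (hd : 2 ≤ d) (hk : 2 ≤ k)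
    {K : Set (EuclideanSpace ℝ (Fin d))} (hK : K ∈ symmConvexBodies d) (hC : IsAffineCube K) :
    (k - 1) * 2 ^ d ∈ diametralSizes K k := by
  obtain ⟨x, hx⟩ := KDiametral.exists_isVertexConfig hC (k - 1)
  exact ⟨Nat.mul_pos (by omega) (by positivity), x,
    hx.isKDiametral hd hk hK hC (IsHomothetic.refl K)⟩

theorem diametralNumber_eq_of_isAffineCube (hd : 2 ≤ d) (hk : 2 ≤ k)
    {K : Set (EuclideanSpace ℝ (Fin d))} (hK : K ∈ symmConvexBodies d) (hC : IsAffineCube K) :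
    diametralNumber K k = (k - 1) * 2 ^ d := by
  have h := isGreatest_diametralNumber (by omega) hk hK
  exact le_antisymm (le_of_mem_antipodalSizes (diametralSizes_subset_antipodalSizes hK h.1))
    (h.2 (mem_diametralSizes_of_isAffineCube hd hk hK hC))

theorem isGreatest_antipodalSizes (hd : 2 ≤ d) (hk : 2 ≤ k) :
    IsGreatest (antipodalSizes d k) ((k - 1) * 2 ^ d) := by
  obtain ⟨K, hK, hC⟩ := exists_isAffineCube_mem_symmConvexBodies d
  exact ⟨diametralSizes_subset_antipodalSizes hK (mem_diametralSizes_of_isAffineCube hd hk hK hC),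
    fun _ hm => le_of_mem_antipodalSizes hm⟩

end Extremal
end KDiametral

/-! ### Assembly of the three assertions. -/

theorem mainTheorem1 (d k : ℕ) (hd : 2 ≤ d) (hk : 2 ≤ k) :
    -- `k`-antipodal means `k`-diametral in some Minkowski space
    (∀ (n : ℕ), 1 ≤ n → ∀ x : Fin n → EuclideanSpace ℝ (Fin d),
      (k ≤ n ∨ ∃ i j, x i ≠ x j) →
        (KDiametral.IsKAntipodal k x ↔
          ∃ K ∈ KDiametral.symmConvexBodies d, KDiametral.IsKDiametral K k x)) ∧
    -- the numbers `F_k(d)` and `f_k` are attained maxima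
    IsGreatest (KDiametral.antipodalSizes d k) (KDiametral.antipodalNumber d k) ∧
    (∀ K ∈ KDiametral.symmConvexBodies d,
      IsGreatest (KDiametral.diametralSizes K k) (KDiametral.diametralNumber K k)) ∧
    -- `F_k(d) = max f_k = (k - 1) 2^d`
    KDiametral.antipodalNumber d k = (k - 1) * 2 ^ d ∧
    IsGreatest ((fun K => KDiametral.diametralNumber K k) '' KDiametral.symmConvexBodies d)
      ((k - 1) * 2 ^ d) ∧
    -- the equality case
    (∀ K ∈ KDiametral.symmConvexBodies d,
      (KDiametral.diametralNumber K k = (k - 1) * 2 ^ d ↔ KDiametral.IsAffineCube K)) ∧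
    -- the extremal configurations
    (∀ K ∈ KDiametral.symmConvexBodies d, KDiametral.IsAffineCube K →
      ∀ x : Fin ((k - 1) * 2 ^ d) → EuclideanSpace ℝ (Fin d),
        (KDiametral.IsKDiametral K k x ↔
          ∃ C : Set (EuclideanSpace ℝ (Fin d)),
            KDiametral.IsAffineCube C ∧ KDiametral.IsHomothetic C K ∧
              KDiametral.IsVertexConfig C (k - 1) x)) := by
  open KDiametral in
  have hpos : 1 ≤ (k - 1) * 2 ^ d := Nat.mul_pos (by omega) (by positivity)
  have hF : antipodalNumber d k = (k - 1) * 2 ^ d := (isGreatest_antipodalSizes hd hk).csSup_eq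
  refine ⟨fun n _ x hx => ⟨fun h => h.exists_isKDiametral hx, ?_⟩,
    hF ▸ isGreatest_antipodalSizes hd hk, fun K hK => isGreatest_diametralNumber (by omega) hk hK,
    hF, ⟨?_, ?_⟩, fun K hK => ⟨fun h => ?_, diametralNumber_eq_of_isAffineCube hd hk hK⟩,
    fun K hK _ x => ⟨fun h => h.exists_isVertexConfig (by omega) hpos hk hK rfl, ?_⟩⟩
  · rintro ⟨K, hK, h⟩
    exact h.isKAntipodal hK
  · obtain ⟨K, hK, hC⟩ := exists_isAffineCube_mem_symmConvexBodies d
    exact ⟨K, hK, diametralNumber_eq_of_isAffineCube hd hk hK hC⟩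
  · rintro _ ⟨K, hK, rfl⟩
    exact le_of_mem_antipodalSizes (diametralSizes_subset_antipodalSizes hK
      (isGreatest_diametralNumber (by omega) hk hK).1)
  · have hmem := (isGreatest_diametralNumber (by omega) hk hK).1
    rw [h] at hmem
    obtain ⟨-, x, hx⟩ := hmem
    obtain ⟨C, hC, hCK, -⟩ := hx.exists_isVertexConfig (by omega) hpos hk hK rfl
    exact hC.of_isHomothetic hCK
  · rintro ⟨C, hC, hCK, hx⟩
    exact hx.isKDiametral hd hk hK hC hCK
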